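/- Let $d\ge 1$, $0<\Theta<1$, $0<p_0,p_1<\infty$, $0<q_0,q_1\le\infty$ and $s_0,s_1\in\mathbb R$. Put $$\frac1p=\frac{1-\Theta}{p_0}+\frac{\Theta}{p_1},\qquad \frac1q=\frac{1-\Theta}{q_0}+\frac{\Theta}{q_1},\qquad s=(1-\Theta)s_0+\Theta s_1 .$$ Let $\mathcal A_\infty^{\ell oc}=\bigcup_{1<r<\infty}\mathcal A_r^{\ell oc}$, where $\mathcal A_r^{\ell oc}$ is the class of all nonnegative, locally integrable, almost everywhere positive functions $w$ on $\mathbb R^d$ with $$\sup_{|B|\le 1}\Big(\frac1{|B|}\int_B w\,dx\Big)^{1/r}\Big(\frac1{|B|}\int_B w^{-r'/r}\,dx\Big)^{1/r'}<\infty ,\qquad \frac1r+\frac1{r'}=1,$$ the supremum being taken over all balls $B\subset\mathbb R^d$ of volume at most $1$. Let $w_0,w_1\in\mathcal A_\infty^{\ell oc}$ and $$w=w_0^{(1-\Theta)p/p_0}\,w_1^{\Theta p/p_1}.$$ For $j\in\mathbb N_0$ and $k\in\mathbb Z^d$ let $\mathcal X_{j,k}$ be the characteristic function of the dyadic cube $Q_{j,k}=\prod_{\ell=1}^d[2^{-j}k_\ell,2^{-j}(k_\ell+1))$.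 The space $f^s_{p,q}(\mathbb R^d,w)$ consists of all complex sequences $\lambda=(\lambda_{j,k})_{j\in\mathbb N_0,k\in\mathbb Z^d}$ with $$\|\lambda\,|\,f^s_{p,q}(\mathbb R^d,w)\|=\bigg(\int_{\mathbb R^d}\Big(\sum_{j=0}^\infty\sum_{k\in\mathbb Z^d}2^{sjq}|\lambda_{j,k}|^q\mathcal X_{j,k}(x)\Big)^{p/q}w(x)\,dx\bigg)^{1/p}<\infty$$ (with the inner $\ell_q$-quasi-norm replaced by the supremum if $q=\infty$), and $\mathring f^s_{p,q}(\mathbb R^d,w)$ is the closure in it of the finite sequences, with the same quasi-norm. For two such spaces $X_0,X_1$ the Calderón product $X_0^{1-\Theta}X_1^\Theta$ is the set of all sequences $\lambda$ for which $$\|\lambda\,|\,X_0^{1-\Theta}X_1^\Theta\|=\inf\big\{\|\lambda^0|X_0\|^{1-\Theta}\|\lambda^1|X_1\|^{\Theta}:\ |\lambda_{j,k}|\le|\lambda^0_{j,k}|^{1-\Theta}|\lambda^1_{j,k}|^\Theta\ \text{for all } j,k,\ \lambda^0\in X_0,\ \lambda^1\in X_1\big\}$$ is finite ($\inf\emptyset=\infty$).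 Then $$\mathring f^{s_0}_{p_0,q_0}(\mathbb R^d,w_0)^{1-\Theta}\,\mathring f^{s_1}_{p_1,q_1}(\mathbb R^d,w_1)^{\Theta}=\mathring f^s_{p,q}(\mathbb R^d,w)$$ and $$\mathring f^{s_0}_{p_0,q_0}(\mathbb R^d,w_0)^{1-\Theta}\,f^{s_1}_{p_1,q_1}(\mathbb R^d,w_1)^{\Theta}=f^{s_0}_{p_0,q_0}(\mathbb R^d,w_0)^{1-\Theta}\,\mathring f^{s_1}_{p_1,q_1}(\mathbb R^d,w_1)^{\Theta}=\mathring f^s_{p,q}(\mathbb R^d,w)$$ hold in the sense of equality of sets with equivalent quasi-norms. -/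

import Mathlib

open scoped ENNReal NNReal

noncomputable section

namespace WeightedSeq

/-! ### Local Muckenhoupt weights -/

/-- The local Muckenhoupt class `A_r^loc` (for `1 < r < ∞`) on `ℝ^d`: nonnegative, locally integrable
functions `w` such that
`(|B|⁻¹ ∫_B w)^(1/r) * (|B|⁻¹ ∫_B w^(-r'/r))^(1/r')`
is bounded over all Euclidean balls `B` with `|B| ≤ 1`, where `r' = r / (r - 1)`.
The integrals take values in `[0, ∞]` and a negative power of `0` is `∞`. Mathlib's convention
`0 * ∞ = 0` would admit the weight that vanishes almost everywhere, which is not a Muckenhoupt weight;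
the clause `∀ᵐ x, 0 < w x` rules it out (for all other weights it follows from the bound). -/
def IsLocMuckenhoupt (d : ℕ) (r : ℝ) (w : EuclideanSpace ℝ (Fin d) → ℝ) : Prop :=
  (∀ x, 0 ≤ w x) ∧ MeasureTheory.LocallyIntegrable w MeasureTheory.volume ∧
  (∀ᵐ x ∂(MeasureTheory.volume : MeasureTheory.Measure (EuclideanSpace ℝ (Fin d))), 0 < w x) ∧
  ∃ C : ℝ≥0, ∀ (c : EuclideanSpace ℝ (Fin d)) (ρ : ℝ), 0 < ρ →
    MeasureTheory.volume (Metric.ball c ρ) ≤ 1 →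
    ((MeasureTheory.volume (Metric.ball c ρ))⁻¹ *
        ∫⁻ x in Metric.ball c ρ, ENNReal.ofReal (w x)) ^ (1 / r) *
      ((MeasureTheory.volume (Metric.ball c ρ))⁻¹ *
        ∫⁻ x in Metric.ball c ρ,
          ENNReal.ofReal (w x) ^ (-(r / (r - 1)) / r)) ^ (1 / (r / (r - 1))) ≤ (C : ℝ≥0∞)

/-- The class `A_∞^loc`, the union of the classes `A_r^loc` over `1 < r < ∞`. -/
def IsLocMuckenhouptInfty (d : ℕ) (w : EuclideanSpace ℝ (Fin d) → ℝ) : Prop :=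
  ∃ r : ℝ, 1 < r ∧ IsLocMuckenhoupt d r w

/-! ### Quasi-normed spaces of functions on an index set and Calderón products -/

/-- A set of complex-valued functions on `ι` together with a functional with values in `[0, ∞]`.
It only serves to carry the underlying set and the quasi-norm of the concrete spaces below;
the values of `qnorm` outside `carrier` are irrelevant. -/
structure QSpace (ι : Type) where
  carrier : Set (ι → ℂ)
  qnorm : (ι → ℂ) → ℝ≥0∞

/-- The Calderón product `X₀^(1-Θ) X₁^Θ` of spaces of functions on `ι` with the counting measure
(so that every function is measurable and almost everywhere means everywhere). -/
def calderonProduct {ι : Type} (Θ : ℝ) (X₀ X₁ : QSpace ι) : QSpace ι where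
  carrier := {f | (⨅ (f₀ ∈ X₀.carrier) (f₁ ∈ X₁.carrier)
    (_ : ∀ i, ‖f i‖ ≤ ‖f₀ i‖ ^ (1 - Θ) * ‖f₁ i‖ ^ Θ),
      X₀.qnorm f₀ ^ (1 - Θ) * X₁.qnorm f₁ ^ Θ) < ⊤}
  qnorm f := ⨅ (f₀ ∈ X₀.carrier) (f₁ ∈ X₁.carrier)
    (_ : ∀ i, ‖f i‖ ≤ ‖f₀ i‖ ^ (1 - Θ) * ‖f₁ i‖ ^ Θ),
      X₀.qnorm f₀ ^ (1 - Θ) * X₁.qnorm f₁ ^ Θ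

/-- Equality of two spaces in the sense of equivalent quasi-norms. -/
def EqEquiv {ι : Type} (X Y : QSpace ι) : Prop :=
  X.carrier = Y.carrier ∧
  ∃ c C : ℝ≥0, 0 < c ∧ 0 < C ∧ ∀ f ∈ X.carrier,
    (c : ℝ≥0∞) * X.qnorm f ≤ Y.qnorm f ∧ Y.qnorm f ≤ (C : ℝ≥0∞) * X.qnorm f

/-- The closure in `X` of the finite sequences (the functions with finite support that lie in `X`),
with the quasi-norm of `X`. -/
def finClosure {ι : Type} (X : QSpace ι) : QSpace ι where
  carrier := {f | f ∈ X.carrier ∧ ∀ ε : ℝ≥0∞, 0 < ε →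
    ∃ g ∈ X.carrier, (Function.support g).Finite ∧ X.qnorm (f - g) < ε}
  qnorm := X.qnorm

/-! ### The weighted sequence spaces `f^s_{p,q}(ℝ^d, w)` -/

/-- The dyadic cube `Q_{j,k}`, `j ∈ ℕ₀`, `k ∈ ℤ^d`. -/
def dyadicCube (d : ℕ) (j : ℕ) (k : Fin d → ℤ) : Set (EuclideanSpace ℝ (Fin d)) :=
  {x | ∀ l, (2 : ℝ) ^ (-(j : ℝ)) * (k l : ℝ) ≤ x l ∧ x l < (2 : ℝ) ^ (-(j : ℝ)) * ((k l : ℝ) + 1)}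

/-- The term `2^(s j) |λ_{j,k}| χ_{j,k}(x)`, with `i = (j, k)`. -/
def fTerm (d : ℕ) (s : ℝ) (a : ℕ × (Fin d → ℤ) → ℂ) (x : EuclideanSpace ℝ (Fin d))
    (i : ℕ × (Fin d → ℤ)) : ℝ≥0∞ :=
  (2 : ℝ≥0∞) ^ (s * (i.1 : ℝ)) * ‖a i‖ₑ * (dyadicCube d i.1 i.2).indicator (fun _ => 1) x

open Classical in
/-- The function `(∑_{j,k} 2^(s j q) |λ_{j,k}|^q χ_{j,k}(x))^(1/q)`, a supremum if `q = ∞`. -/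
def fFun (d : ℕ) (s : ℝ) (q : ℝ≥0∞) (a : ℕ × (Fin d → ℤ) → ℂ)
    (x : EuclideanSpace ℝ (Fin d)) : ℝ≥0∞ :=
  if q = ⊤ then ⨆ i, fTerm d s a x i
  else (∑' i, fTerm d s a x i ^ q.toReal) ^ (1 / q.toReal)

/-- The quasi-norm of `f^s_{p,q}(ℝ^d, w)`, the `L_p(ℝ^d, w)` quasi-norm of `fFun`. -/
def fNorm (d : ℕ) (s p : ℝ) (q : ℝ≥0∞) (w : EuclideanSpace ℝ (Fin d) → ℝ)
    (a : ℕ × (Fin d → ℤ) → ℂ) : ℝ≥0∞ :=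
  (∫⁻ x, fFun d s q a x ^ p * ENNReal.ofReal (w x)) ^ (1 / p)

/-- The sequence space `f^s_{p,q}(ℝ^d, w)`, for `0 < p < ∞` and `0 < q ≤ ∞`. -/
def fSpace (d : ℕ) (s p : ℝ) (q : ℝ≥0∞) (w : EuclideanSpace ℝ (Fin d) → ℝ) :
    QSpace (ℕ × (Fin d → ℤ)) where
  carrier := {a | fNorm d s p q w a < ⊤}
  qnorm := fNorm d s p q w

/-- The closure of the finite sequences in `f^s_{p,q}(ℝ^d, w)`. -/
def fRing (d : ℕ) (s p : ℝ) (q : ℝ≥0∞) (w : EuclideanSpace ℝ (Fin d) → ℝ) :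
    QSpace (ℕ × (Fin d → ℤ)) :=
  finClosure (fSpace d s p q w)

end WeightedSeq

end

open scoped ENNReal NNReal
open MeasureTheory Filter Topology

/-! One inclusion is Hölder's inequality, used in `ℓ_q` at each point and then for the integrals
(`fNorm_le_of_dominated`). Restricting all sequences to the complement of a finite set shows that a
single factor from a closure of the finite sequences already puts the dominated sequence into the
closure.

For the converse a sequence `a` has to be factored. Let `F` be the function whose weighted `L_p`
quasi-norm is the quasi-norm of `a`. If multipliers could depend on the point, the coefficients `|a|
^ θᵢ` times `F ^ (p / pᵢ - θᵢ) * (w / wᵢ) ^ (1 / pᵢ)` would have the right size in both spaces.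
Their powers with exponents `1 - Θ` and `Θ` multiply to `|a|`, since the two multipliers then become
`u` and `1 / u` for one function `u`. A multiplier must be constant on each dyadic cube, so `u` is
replaced there by an approximate median `m` (`exists_median`): `m ≤ 2 * u` on one half of the cube
and `u ≤ m` on another half. Each factor is thus controlled on a fixed portion of every cube
(`exists_factor`).

This is enough. For a local Muckenhoupt weight such portions have comparable weight
(`IsLocMuckenhoupt.exists_dyadicCube_le`), and then cubes may be replaced by portions inside the
quasi-norm (`LevelSystem.exists_lintegral_lnorm_le`). The latter is proved by summation along the
nested dyadic partitions, without maximal functions. Only `w₀` and `w₁` need the weight property,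
not `w`.

To factor within the closures, a member `a` of the closure is multiplied by numbers `c ≥ 1` tending
to infinity so slowly that `c * a` stays in the space (`exists_multiplier`). The product `c * a` is
factored and both factors are divided by `c`, which is consistent because `c ^ (1 - Θ) * c ^ Θ = c`.
The division moves them into the closures (`div_mem_fRing`), so the same factors serve all three
products. -/

namespace WeightedSeq

/-! ### The sequence quasi-norm of `ℓ_q` -/

section Sequences

variable {ι : Type*}

open Classical in
/-- The `ℓ_q` quasi-norm of a family of extended nonnegative numbers. -/
noncomputable def lnorm (q : ℝ≥0∞) (a : ι → ℝ≥0∞) : ℝ≥0∞ :=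
  if q = ⊤ then ⨆ i, a i else (∑' i, a i ^ q.toReal) ^ (1 / q.toReal)

lemma lnorm_top (a : ι → ℝ≥0∞) : lnorm ⊤ a = ⨆ i, a i := if_pos rfl

lemma lnorm_of_ne_top {q : ℝ≥0∞} (hq : q ≠ ⊤) (a : ι → ℝ≥0∞) :
    lnorm q a = (∑' i, a i ^ q.toReal) ^ (1 / q.toReal) := if_neg hq

lemma lnorm_mono {q : ℝ≥0∞} {a b : ι → ℝ≥0∞} (h : ∀ i, a i ≤ b i) : lnorm q a ≤ lnorm q b := by
  by_cases hq : q = ⊤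
  · subst hq
    rw [lnorm_top, lnorm_top]
    exact iSup_mono h
  · rw [lnorm_of_ne_top hq, lnorm_of_ne_top hq]
    gcongr with i
    exact h i

lemma le_lnorm {q : ℝ≥0∞} (hq0 : 0 < q) (a : ι → ℝ≥0∞) (i : ι) : a i ≤ lnorm q a := by
  by_cases hq : q = ⊤
  · subst hq
    rw [lnorm_top]
    exact le_iSup a i
  · rw [lnorm_of_ne_top hq]
    have h : 0 < q.toReal := ENNReal.toReal_pos hq0.ne' hq
    calc a i = (a i ^ q.toReal) ^ (1 / q.toReal) := by
          rw [← ENNReal.rpow_mul, mul_one_div_cancel h.ne', ENNReal.rpow_one]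
      _ ≤ _ := by
          gcongr
          exact ENNReal.le_tsum i

lemma lnorm_const_mul {q : ℝ≥0∞} (hq0 : 0 < q) (c : ℝ≥0∞) (a : ι → ℝ≥0∞) :
    lnorm q (fun i => c * a i) = c * lnorm q a := by
  by_cases hq : q = ⊤
  · subst hq
    rw [lnorm_top, lnorm_top, ENNReal.mul_iSup]
  · rw [lnorm_of_ne_top hq, lnorm_of_ne_top hq]
    have h : 0 < q.toReal := ENNReal.toReal_pos hq0.ne' hq
    simp_rw [ENNReal.mul_rpow_of_nonneg _ _ h.le]
    rw [ENNReal.tsum_mul_left, ENNReal.mul_rpow_of_nonneg _ _ (by positivity), ← ENNReal.rpow_mul,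
      mul_one_div_cancel h.ne', ENNReal.rpow_one]

/-- The elementary relation between `ℓ_q` quasi-norms of powers. -/
lemma lnorm_rpow_le {q q₀ : ℝ≥0∞} (hq : 0 < q) (hq₀ : 0 < q₀) {θ : ℝ} (hθ : 0 ≤ θ)
    (h : q₀ = ⊤ ∨ (q₀ ≠ ⊤ ∧ q ≠ ⊤ ∧ θ * q₀.toReal = q.toReal)) (a : ι → ℝ≥0∞) :
    lnorm q₀ (fun i => a i ^ θ) ≤ lnorm q a ^ θ := by
  rcases h with h | ⟨h₀, h, e⟩
  · subst h
    rw [lnorm_top]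
    exact iSup_le fun i => ENNReal.rpow_le_rpow (le_lnorm hq a i) hθ
  · have hp : 0 < q.toReal := ENNReal.toReal_pos hq.ne' h
    have hp₀ : 0 < q₀.toReal := ENNReal.toReal_pos hq₀.ne' h₀
    rw [lnorm_of_ne_top h₀, lnorm_of_ne_top h]
    simp_rw [← ENNReal.rpow_mul, e]
    apply le_of_eq
    congr 1
    rw [← e]
    have : θ ≠ 0 := by
      rintro rfl
      simp at e
      linarith
    field_simp

lemma tsum_rpow_mul_rpow_le (f g : ι → ℝ≥0∞) {α β : ℝ} (hα : 0 ≤ α)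
    (hβ : 0 ≤ β) (h : α + β = 1) :
    ∑' i, f i ^ α * g i ^ β ≤ (∑' i, f i) ^ α * (∑' i, g i) ^ β := by
  let _ : MeasurableSpace ι := ⊤
  have := ENNReal.lintegral_mul_norm_pow_le (μ := Measure.count) (f := f) (g := g)
    (Measurable.of_discrete).aemeasurable (Measurable.of_discrete).aemeasurable hα hβ h
  simpa only [lintegral_count] using this

/-- Hölder's inequality for the `ℓ_q` quasi-norms. -/
lemma lnorm_mul_le {q q₀ q₁ : ℝ≥0∞} (hq₀ : 0 < q₀) (hq₁ : 0 < q₁) {Θ : ℝ} (h0 : 0 < Θ)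
    (h1 : Θ < 1) (hq : 1 / q = ENNReal.ofReal (1 - Θ) / q₀ + ENNReal.ofReal Θ / q₁)
    (a b : ι → ℝ≥0∞) :
    lnorm q (fun i => a i ^ (1 - Θ) * b i ^ Θ) ≤ lnorm q₀ a ^ (1 - Θ) * lnorm q₁ b ^ Θ := by
  have hΘ : 0 < 1 - Θ := by linarith
  by_cases hqt : q = ⊤
  · subst hqt
    rw [lnorm_top]
    refine iSup_le fun i => ?_
    gcongr
    · exact le_lnorm hq₀ a i
    · exact le_lnorm hq₁ b i
  have hqpos : 0 < q := by
    rw [pos_iff_ne_zero]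
    rintro rfl
    have : ENNReal.ofReal (1 - Θ) / q₀ + ENNReal.ofReal Θ / q₁ ≠ ⊤ :=
      ENNReal.add_ne_top.2 ⟨ENNReal.div_ne_top ENNReal.ofReal_ne_top hq₀.ne',
        ENNReal.div_ne_top ENNReal.ofReal_ne_top hq₁.ne'⟩
    rw [← hq] at this
    simp at this
  have hqp : 0 < q.toReal := ENNReal.toReal_pos hqpos.ne' hqt
  -- An infinite exponent contributes zero on the real side too, because `toReal ⊤ = 0` and division
  -- by zero gives zero.
  have hreal : 1 / q.toReal = (1 - Θ) / q₀.toReal + Θ / q₁.toReal := by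
    have := congrArg ENNReal.toReal hq
    rwa [ENNReal.toReal_add (ENNReal.div_ne_top ENNReal.ofReal_ne_top hq₀.ne')
      (ENNReal.div_ne_top ENNReal.ofReal_ne_top hq₁.ne'), ENNReal.toReal_div, ENNReal.toReal_div,
      ENNReal.toReal_div, ENNReal.toReal_ofReal hΘ.le, ENNReal.toReal_ofReal h0.le,
      ENNReal.toReal_one] at this
  rw [lnorm_of_ne_top hqt]
  have key : ∑' i, (a i ^ (1 - Θ) * b i ^ Θ) ^ q.toReal ≤
      (lnorm q₀ a ^ (1 - Θ) * lnorm q₁ b ^ Θ) ^ q.toReal := by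
    simp_rw [ENNReal.mul_rpow_of_nonneg _ _ hqp.le]
    by_cases ht₀ : q₀ = ⊤
    · have ht₁ : q₁ ≠ ⊤ := by
        rintro rfl
        subst ht₀
        simp [hqp.ne'] at hreal
      have hq₁p : 0 < q₁.toReal := ENNReal.toReal_pos hq₁.ne' ht₁
      have e : Θ * q.toReal = q₁.toReal := by
        subst ht₀
        simp only [ENNReal.toReal_top, div_zero, zero_add] at hreal
        field_simp at hreal
        linarith
      calc ∑' i, (a i ^ (1 - Θ)) ^ q.toReal * (b i ^ Θ) ^ q.toReal
          ≤ ∑' i, (lnorm q₀ a ^ (1 - Θ)) ^ q.toReal * b i ^ q₁.toReal := by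
            gcongr with i
            · exact le_lnorm hq₀ a i
            · rw [← ENNReal.rpow_mul, e]
        _ = _ := by
            rw [ENNReal.tsum_mul_left, lnorm_of_ne_top ht₁, ← ENNReal.rpow_mul _ Θ, e,
              ← ENNReal.rpow_mul _ (1 / q₁.toReal), one_div_mul_cancel hq₁p.ne', ENNReal.rpow_one]
    by_cases ht₁ : q₁ = ⊤
    · have hq₀p : 0 < q₀.toReal := ENNReal.toReal_pos hq₀.ne' ht₀
      have e : (1 - Θ) * q.toReal = q₀.toReal := by
        subst ht₁
        simp only [ENNReal.toReal_top, div_zero, add_zero] at hreal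
        field_simp at hreal
        linarith
      calc ∑' i, (a i ^ (1 - Θ)) ^ q.toReal * (b i ^ Θ) ^ q.toReal
          ≤ ∑' i, a i ^ q₀.toReal * (lnorm q₁ b ^ Θ) ^ q.toReal := by
            gcongr with i
            · rw [← ENNReal.rpow_mul, e]
            · exact le_lnorm hq₁ b i
        _ = _ := by
            rw [ENNReal.tsum_mul_right, lnorm_of_ne_top ht₀, ← ENNReal.rpow_mul _ (1 - Θ), e,
              ← ENNReal.rpow_mul _ (1 / q₀.toReal), one_div_mul_cancel hq₀p.ne', ENNReal.rpow_one]
    have hq₀p : 0 < q₀.toReal := ENNReal.toReal_pos hq₀.ne' ht₀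
    have hq₁p : 0 < q₁.toReal := ENNReal.toReal_pos hq₁.ne' ht₁
    have hsum : (1 - Θ) * q.toReal / q₀.toReal + Θ * q.toReal / q₁.toReal = 1 := by
      have : q.toReal * (1 / q.toReal) = 1 := mul_one_div_cancel hqp.ne'
      rw [hreal] at this
      linear_combination this
    calc ∑' i, (a i ^ (1 - Θ)) ^ q.toReal * (b i ^ Θ) ^ q.toReal
        = ∑' i, (a i ^ q₀.toReal) ^ ((1 - Θ) * q.toReal / q₀.toReal) *
            (b i ^ q₁.toReal) ^ (Θ * q.toReal / q₁.toReal) := by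
          congr 1 with i
          simp_rw [← ENNReal.rpow_mul]
          congr 2 <;> field_simp
      _ ≤ _ := tsum_rpow_mul_rpow_le _ _ (by positivity) (by positivity) hsum
      _ = _ := by
          rw [lnorm_of_ne_top ht₀, lnorm_of_ne_top ht₁]
          simp_rw [← ENNReal.rpow_mul]
          congr 2 <;> field_simp
  calc _ ≤ ((lnorm q₀ a ^ (1 - Θ) * lnorm q₁ b ^ Θ) ^ q.toReal) ^ (1 / q.toReal) := by gcongr
    _ = _ := by rw [← ENNReal.rpow_mul, mul_one_div_cancel hqp.ne', ENNReal.rpow_one]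

/-- Increments of a concave power decrease with the base point. -/
lemma rpow_add_tsub_le {r : ℝ} (h0 : 0 < r) (h1 : r ≤ 1) {G B b : ℝ≥0∞} (hGB : G ≤ B)
    (hB : B ≠ ⊤) (hb : b ≠ ⊤) : (B + b) ^ r + G ^ r ≤ (G + b) ^ r + B ^ r := by
  lift B to ℝ≥0 using hB
  lift b to ℝ≥0 using hb
  lift G to ℝ≥0 using (ne_top_of_le_ne_top ENNReal.coe_ne_top hGB)
  have hGB' : G ≤ B := by exact_mod_cast hGB
  have main : ((B : ℝ) + b) ^ r + (G : ℝ) ^ r ≤ ((G : ℝ) + b) ^ r + (B : ℝ) ^ r := by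
    have hGB'' : (G : ℝ) ≤ B := by exact_mod_cast hGB'
    have hG0 : (0 : ℝ) ≤ G := G.2
    have hb0 : (0 : ℝ) ≤ b := b.2
    have hB0 : (0 : ℝ) ≤ B := B.2
    generalize (G : ℝ) = x at *
    generalize (B : ℝ) = y at *
    generalize (b : ℝ) = z at *
    rcases (by linarith : 0 ≤ y + z - x).eq_or_lt with h | h
    · have : y = x := by linarith
      subst this
      rfl
    -- Both `y` and `x + z` are convex combinations of `x` and `y + z`, with the two weights
    -- interchanged; the sum of the two concavity inequalities is the claim.
    have hc := (Real.concaveOn_rpow h0.le h1).2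
    have ht : 0 ≤ (y - x) / (y + z - x) := by
      apply div_nonneg <;> linarith
    have ht' : 0 ≤ z / (y + z - x) := by positivity
    have hs : (y - x) / (y + z - x) + z / (y + z - x) = 1 := by
      field_simp
      ring
    have e1 := hc (x := y + z) (y := x) (by simp; linarith) (by simpa) ht ht' hs
    have e2 := hc (x := y + z) (y := x) (by simp; linarith) (by simpa) ht' ht (by linarith)
    simp only [smul_eq_mul] at e1 e2
    have a1 : (y - x) / (y + z - x) * (y + z) + z / (y + z - x) * x = y := by
      field_simp
      ring
    have a2 : z / (y + z - x) * (y + z) + (y - x) / (y + z - x) * x = x + z := by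
      field_simp
      ring
    rw [a1] at e1
    rw [a2] at e2
    have : (y + z) ^ r + x ^ r = ((y - x) / (y + z - x) + z / (y + z - x)) * ((y + z) ^ r + x ^ r) := by
      rw [hs, one_mul]
    rw [this]
    linarith
  have : ((B + b) ^ r + G ^ r : ℝ≥0) ≤ (G + b) ^ r + B ^ r := by
    rw [← NNReal.coe_le_coe]
    push_cast
    exact main
  rw [← ENNReal.coe_add, ← ENNReal.coe_add, ← ENNReal.coe_rpow_of_nonneg _ h0.le,
    ← ENNReal.coe_rpow_of_nonneg _ h0.le, ← ENNReal.coe_rpow_of_nonneg _ h0.le,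
    ← ENNReal.coe_rpow_of_nonneg _ h0.le]
  exact_mod_cast this

/-- The convex power lies above its tangent at `B + b`; after division by `(B + b) ^ r` this is
Bernoulli's inequality. -/
lemma add_rpow_le_add_mul {r : ℝ} (h1 : 1 ≤ r) {B b : ℝ≥0∞} (hB : B ≠ ⊤) (hb : b ≠ ⊤) :
    (B + b) ^ r ≤ B ^ r + ENNReal.ofReal r * (b * (B + b) ^ (r - 1)) := by
  lift B to ℝ≥0 using hB
  lift b to ℝ≥0 using hb
  have main : ((B : ℝ) + b) ^ r ≤ (B : ℝ) ^ r + r * (b * ((B : ℝ) + b) ^ (r - 1)) := by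
    have hb0 : (0 : ℝ) ≤ b := b.2
    have hB0 : (0 : ℝ) ≤ B := B.2
    generalize (B : ℝ) = y at *
    generalize (b : ℝ) = z at *
    rcases (by linarith : 0 ≤ y + z).eq_or_lt with h | h
    · have hy : y = 0 := by linarith
      have hz : z = 0 := by linarith
      subst hy hz
      simp
    have := one_add_mul_self_le_rpow_one_add (s := -(z / (y + z))) (by
      rw [neg_le_neg_iff, div_le_one h]
      linarith) h1
    have e : 1 + -(z / (y + z)) = y / (y + z) := by
      field_simp
      ring
    rw [e, Real.div_rpow hB0 h.le, le_div_iff₀ (by positivity)] at this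
    rw [Real.rpow_sub h, Real.rpow_one]
    have e2 : (1 + r * -(z / (y + z))) * (y + z) ^ r =
      (y + z) ^ r - r * (z * ((y + z) ^ r / (y + z))) := by
      field_simp
      ring
    linarith
  have h0 : 0 ≤ r := by linarith
  have h0' : 0 ≤ r - 1 := by linarith
  have : ((B + b) ^ r : ℝ≥0) ≤ B ^ r + r.toNNReal * (b * (B + b) ^ (r - 1)) := by
    rw [← NNReal.coe_le_coe]
    push_cast
    rw [Real.coe_toNNReal _ h0]
    exact main
  rw [ENNReal.ofReal, ← ENNReal.coe_add, ← ENNReal.coe_rpow_of_nonneg _ h0,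
    ← ENNReal.coe_rpow_of_nonneg _ h0, ← ENNReal.coe_rpow_of_nonneg _ h0']
  exact_mod_cast this

end Sequences

/-! ### Replacing cubes by large subsets -/

section Levels

/-- The data for comparing sums over nested partitions with sums over portions of their cells:
`κ j` labels the cells of the partition number `j`, and functions that are constant on these cells
have comparable integrals over the whole space and over `e j`. -/
structure LevelSystem {α β : Type*} [MeasurableSpace α] (μ : Measure α) (κ : ℕ → α → β)
    (e : ℕ → Set α) (K : ℝ≥0∞) : Prop where
  nested : ∀ i j, i ≤ j → Function.FactorsThrough (κ i) (κ j)
  meas : ∀ j (h : α → ℝ≥0∞), Function.FactorsThrough h (κ j) → Measurable h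
  measSet : ∀ j, MeasurableSet (e j)
  le : ∀ j (h : α → ℝ≥0∞), Function.FactorsThrough h (κ j) →
    ∫⁻ x, h x ∂μ ≤ K * ∫⁻ x, (e j).indicator h x ∂μ

variable {α β : Type*} [MeasurableSpace α] {μ : Measure α} {κ : ℕ → α → β} {e : ℕ → Set α}
  {K : ℝ≥0∞}

namespace LevelSystem

/-- The comparison in `LevelSystem` is linear, so it can be summed over levels. Each nonlinear
estimate below amounts to finding increments `φ j`, constant on the cells of level `j`, that
dominate `S` in total while their portions stay below `G`. -/
lemma lintegral_le_of_tsum (H : LevelSystem μ κ e K) {φ : ℕ → α → ℝ≥0∞}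
    (hφ : ∀ j, Function.FactorsThrough (φ j) (κ j)) {S G : α → ℝ≥0∞}
    (hS : ∀ x, S x ≤ ∑' j, φ j x) (hG : ∀ x, ∑' j, (e j).indicator (φ j) x ≤ G x) :
    ∫⁻ x, S x ∂μ ≤ K * ∫⁻ x, G x ∂μ :=
  calc ∫⁻ x, S x ∂μ ≤ ∫⁻ x, ∑' j, φ j x ∂μ := lintegral_mono hS
    _ = ∑' j, ∫⁻ x, φ j x ∂μ := lintegral_tsum fun j => (H.meas j _ (hφ j)).aemeasurable
    _ ≤ ∑' j, K * ∫⁻ x, (e j).indicator (φ j) x ∂μ := ENNReal.tsum_le_tsum fun j => H.le j _ (hφ j)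
    _ = K * ∫⁻ x, ∑' j, (e j).indicator (φ j) x ∂μ := by
        rw [ENNReal.tsum_mul_left, lintegral_tsum]
        exact fun j => ((H.meas j _ (hφ j)).indicator (H.measSet j)).aemeasurable
    _ ≤ _ := by
        gcongr with x
        exact hG x

lemma factors_sum (H : LevelSystem μ κ e K) {b : ℕ → α → ℝ≥0∞}
    (hb : ∀ j, Function.FactorsThrough (b j) (κ j)) {n m : ℕ} (hnm : n ≤ m + 1) :
    Function.FactorsThrough (fun x => ∑ j ∈ Finset.range n, b j x) (κ m) := by
  intro x y hxy
  refine Finset.sum_congr rfl fun j hj => hb j (H.nested j m ?_ hxy)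
  have := Finset.mem_range.1 hj
  omega

lemma factors_sup (H : LevelSystem μ κ e K) {b : ℕ → α → ℝ≥0∞}
    (hb : ∀ j, Function.FactorsThrough (b j) (κ j)) {n m : ℕ} (hnm : n ≤ m + 1) :
    Function.FactorsThrough (fun x => (Finset.range n).sup fun j => b j x) (κ m) := by
  intro x y hxy
  refine Finset.sup_congr rfl fun j hj => hb j (H.nested j m ?_ hxy)
  have := Finset.mem_range.1 hj
  omega

/-- The supremum is the telescoping sum of the increments of the running maxima, and the increment
at `j` is constant on cells of level `j`. -/
lemma lintegral_iSup_le (H : LevelSystem μ κ e K) {b : ℕ → α → ℝ≥0∞}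
    (hb : ∀ j, Function.FactorsThrough (b j) (κ j)) :
    ∫⁻ x, ⨆ j, b j x ∂μ ≤ K * ∫⁻ x, ⨆ j, (e j).indicator (b j) x ∂μ := by
  set M : ℕ → α → ℝ≥0∞ := fun n x => (Finset.range n).sup fun j => b j x with hM
  have hMs : ∀ n x, M (n + 1) x = b n x ⊔ M n x := fun n x => by
    simp only [hM, Finset.range_add_one, Finset.sup_insert]
  have hsum : ∀ n x, ∑ j ∈ Finset.range n, (M (j + 1) x - M j x) = M n x := by
    intro n x
    induction n with
    | zero => simp [hM]
    | succ n ih =>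
      rw [Finset.sum_range_succ, ih]
      exact add_tsub_cancel_of_le (by rw [hMs]; exact le_sup_right)
  refine H.lintegral_le_of_tsum (φ := fun j x => M (j + 1) x - M j x) (fun j x y hxy => ?_)
    (fun x => ?_) (fun x => ?_)
  · have h1 := H.factors_sup hb (le_refl (j + 1)) hxy
    have h2 := H.factors_sup hb (Nat.le_succ j) hxy
    simp only [hM]
    simp only at h1 h2
    rw [h1, h2]
  · refine iSup_le fun j => ?_
    calc b j x ≤ M (j + 1) x := by rw [hMs]; exact le_sup_left
      _ = _ := (hsum _ x).symm
      _ ≤ _ := ENNReal.sum_le_tsum _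
  · rw [ENNReal.tsum_eq_iSup_nat]
    refine iSup_le fun n => ?_
    induction n with
    | zero => simp
    | succ n ih =>
      rw [Finset.sum_range_succ]
      by_cases hx : x ∈ e n
      · rcases le_total (b n x) (M n x) with h | h
        · rw [Set.indicator_of_mem hx, hMs, sup_eq_right.2 h, tsub_self, add_zero]
          exact ih
        -- A positive increment means that `b n x` is a new record. All increments so far then add
        -- up to at most `b n x`, which the right side sees because `x ∈ e n`.
        · calc _ ≤ ∑ j ∈ Finset.range n, (M (j + 1) x - M j x) + (M (n + 1) x - M n x) := by
                gcongr with j hj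
                · exact Set.indicator_le_self _ _ _
                · exact Set.indicator_le_self _ _ _
            _ = M (n + 1) x := by rw [← Finset.sum_range_succ, hsum]
            _ = (e n).indicator (b n) x := by rw [hMs, sup_eq_left.2 h, Set.indicator_of_mem hx]
            _ ≤ _ := le_iSup (fun j => (e j).indicator (b j) x) n
      · rw [Set.indicator_of_notMem hx, add_zero]
        exact ih

/-- The increments are those of the `r`-th powers of the partial sums. Over the portions, concavity
lets each increment be replaced by the larger one based at the smaller sum of the terms visible at
`x`, and these telescope again. -/
lemma lintegral_tsum_rpow_le_of_le_one (H : LevelSystem μ κ e K) {b : ℕ → α → ℝ≥0∞}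
    (hb : ∀ j, Function.FactorsThrough (b j) (κ j)) (hfin : ∀ j x, b j x ≠ ⊤) {r : ℝ} (h0 : 0 < r)
    (h1 : r ≤ 1) :
    ∫⁻ x, (∑' j, b j x) ^ r ∂μ ≤ K * ∫⁻ x, (∑' j, (e j).indicator (b j) x) ^ r ∂μ := by
  set B : ℕ → α → ℝ≥0∞ := fun n x => ∑ j ∈ Finset.range n, b j x with hB
  have hBs : ∀ n x, B (n + 1) x = B n x + b n x := fun n x => Finset.sum_range_succ _ _
  have hBfin : ∀ n x, B n x ≠ ⊤ := fun n x => ENNReal.sum_ne_top.2 fun j _ => hfin j x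
  have hsum : ∀ n x, ∑ j ∈ Finset.range n, (B (j + 1) x ^ r - B j x ^ r) = B n x ^ r := by
    intro n x
    induction n with
    | zero => simp [hB, ENNReal.zero_rpow_of_pos h0]
    | succ n ih =>
      rw [Finset.sum_range_succ, ih]
      refine add_tsub_cancel_of_le (ENNReal.rpow_le_rpow ?_ h0.le)
      rw [hBs]
      exact le_self_add
  refine H.lintegral_le_of_tsum (φ := fun j x => B (j + 1) x ^ r - B j x ^ r) (fun j x y hxy => ?_)
    (fun x => ?_) (fun x => ?_)
  · have h1 := H.factors_sum hb (le_refl (j + 1)) hxy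
    have h2 := H.factors_sum hb (Nat.le_succ j) hxy
    simp only [hB]
    simp only at h1 h2
    rw [h1, h2]
  · have ht : Tendsto (fun n => B n x ^ r) atTop (𝓝 ((∑' j, b j x) ^ r)) :=
      (ENNReal.continuous_rpow_const.tendsto _).comp (ENNReal.tendsto_nat_tsum _)
    refine le_of_tendsto' ht fun n => ?_
    rw [← hsum]
    exact ENNReal.sum_le_tsum _
  · set g : ℕ → ℝ≥0∞ := fun j => (e j).indicator (b j) x with hg
    have hgb : ∀ j, g j ≤ b j x := fun j => Set.indicator_le_self _ _ _
    rw [ENNReal.tsum_eq_iSup_nat]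
    refine iSup_le fun n => ?_
    suffices h : ∑ j ∈ Finset.range n, (e j).indicator (fun x => B (j + 1) x ^ r - B j x ^ r) x ≤
        (∑ j ∈ Finset.range n, g j) ^ r from
      h.trans (ENNReal.rpow_le_rpow (ENNReal.sum_le_tsum _) h0.le)
    induction n with
    | zero => simp
    | succ n ih =>
      rw [Finset.sum_range_succ, Finset.sum_range_succ]
      by_cases hx : x ∈ e n
      · rw [Set.indicator_of_mem hx]
        have hgn : g n = b n x := Set.indicator_of_mem hx _
        have := rpow_add_tsub_le h0 h1 (G := ∑ j ∈ Finset.range n, g j) (B := B n x) (b := b n x)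
          (Finset.sum_le_sum fun j _ => hgb j) (hBfin n x) (hfin n x)
        rw [hgn, hBs]
        calc _ ≤ (∑ j ∈ Finset.range n, g j) ^ r + ((B n x + b n x) ^ r - B n x ^ r) := by gcongr
          _ = ((B n x + b n x) ^ r - B n x ^ r) + (∑ j ∈ Finset.range n, g j) ^ r := add_comm _ _
          _ ≤ _ := by
              have hle : B n x ^ r ≤ (B n x + b n x) ^ r :=
                ENNReal.rpow_le_rpow le_self_add h0.le
              rw [← ENNReal.add_le_add_iff_right (ENNReal.rpow_ne_top_of_nonneg h0.le (hBfin n x)),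
                add_right_comm, tsub_add_cancel_of_le hle]
              exact this
      · have hgn : g n = 0 := Set.indicator_of_notMem hx _
        rw [Set.indicator_of_notMem hx, add_zero, hgn, add_zero]
        exact ih

/-- The tangent bound makes the increments at most `r * b j * B (j + 1) ^ (r - 1)`, so the left
integral `I` is at most `r * K` times the integral of `G * B n ^ (r - 1)`. Hölder's inequality
yields a power of `I` that is absorbed on the left; this needs `I` finite, hence the finite sums. -/
lemma lintegral_sum_rpow_le_of_one_le (H : LevelSystem μ κ e K) {b : ℕ → α → ℝ≥0∞}
    (hb : ∀ j, Function.FactorsThrough (b j) (κ j)) (hfin : ∀ j x, b j x ≠ ⊤) {r : ℝ}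
    (h1 : 1 ≤ r) (hK : K ≠ ⊤) (n : ℕ) :
    ∫⁻ x, (∑ j ∈ Finset.range n, b j x) ^ r ∂μ ≤
      (ENNReal.ofReal r * K) ^ r * ∫⁻ x, (∑' j, (e j).indicator (b j) x) ^ r ∂μ := by
  have h0 : 0 < r := by linarith
  set G : α → ℝ≥0∞ := fun x => ∑' j, (e j).indicator (b j) x with hG
  have hGm : Measurable G := Measurable.tsum fun j => (H.meas j _ (hb j)).indicator (H.measSet j)
  rcases eq_or_ne r 1 with rfl | hr1
  · simp only [ENNReal.rpow_one, ENNReal.ofReal_one, one_mul]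
    exact H.lintegral_le_of_tsum hb (fun x => ENNReal.sum_le_tsum _) fun x => le_rfl
  have h1' : 1 < r := lt_of_le_of_ne h1 (Ne.symm hr1)
  set B : ℕ → α → ℝ≥0∞ := fun n x => ∑ j ∈ Finset.range n, b j x with hB
  have hBs : ∀ n x, B (n + 1) x = B n x + b n x := fun n x => Finset.sum_range_succ _ _
  have hBfin : ∀ n x, B n x ≠ ⊤ := fun n x => ENNReal.sum_ne_top.2 fun j _ => hfin j x
  have hBm : ∀ n, Measurable (B n) := fun n => Finset.measurable_sum _ fun j _ => H.meas j _ (hb j)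
  have hBmono : ∀ x, Monotone fun n => B n x := fun x =>
    monotone_nat_of_le_succ fun n => by rw [hBs]; exact le_self_add
  change ∫⁻ x, B n x ^ r ∂μ ≤ (ENNReal.ofReal r * K) ^ r * ∫⁻ x, G x ^ r ∂μ
  -- With an infinite integral on the right only `K = 0` needs an argument, since `0 * ⊤ = 0`; in
  -- that case the integral of each `b j ^ r` vanishes.
  by_cases hGtop : ∫⁻ x, G x ^ r ∂μ = ⊤
  · rw [hGtop]
    rcases eq_or_ne K 0 with hK0 | hK0
    · have : ∀ j, ∫⁻ x, b j x ^ r ∂μ = 0 := by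
        intro j
        have := H.le j (fun x => b j x ^ r) (fun x y hxy => by simp only [hb j hxy])
        rw [hK0, zero_mul] at this
        exact le_antisymm this zero_le
      have : ∫⁻ x, B n x ^ r ∂μ ≤ 0 := by
        calc _ ≤ ∫⁻ x, ((Finset.range n).card : ℝ≥0∞) ^ (r - 1) *
              ∑ j ∈ Finset.range n, b j x ^ r ∂μ := by
              gcongr with x
              exact ENNReal.rpow_sum_le_const_mul_sum_rpow _ _ h1
          _ = 0 := by
              have hm : ∀ j, Measurable fun x => b j x ^ r := fun j =>
                (H.meas j _ (hb j)).pow_const r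
              rw [lintegral_const_mul _ (Finset.measurable_sum _ fun j _ => hm j),
                lintegral_finsetSum _ fun j _ => hm j]
              simp [this]
      exact this.trans zero_le
    · rw [ENNReal.mul_top]
      · exact le_top
      · have : 0 < ENNReal.ofReal r := by simpa using h0
        exact (ENNReal.rpow_pos (ENNReal.mul_pos this.ne' hK0)
          (ENNReal.mul_ne_top ENNReal.ofReal_ne_top hK)).ne'
  -- A crude bound depending on `n` suffices here: it serves only to permit the cancellation below.
  have hfinB : ∫⁻ x, B n x ^ r ∂μ ≠ ⊤ := by
    refine ne_top_of_le_ne_top ?_ (b := (n : ℝ≥0∞) ^ (r - 1) *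
      ∑ j ∈ Finset.range n, K * ∫⁻ x, G x ^ r ∂μ) ?_
    · refine ENNReal.mul_ne_top (ENNReal.rpow_ne_top_of_nonneg (by linarith) (by simp)) ?_
      exact ENNReal.sum_ne_top.2 fun _ _ => ENNReal.mul_ne_top hK hGtop
    · calc _ ≤ ∫⁻ x, (n : ℝ≥0∞) ^ (r - 1) * ∑ j ∈ Finset.range n, b j x ^ r ∂μ := by
            gcongr with x
            have := ENNReal.rpow_sum_le_const_mul_sum_rpow (Finset.range n) (fun j => b j x) h1
            rwa [Finset.card_range] at this
        _ = (n : ℝ≥0∞) ^ (r - 1) * ∑ j ∈ Finset.range n, ∫⁻ x, b j x ^ r ∂μ := by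
            have hm : ∀ j, Measurable fun x => b j x ^ r := fun j =>
              (H.meas j _ (hb j)).pow_const r
            rw [lintegral_const_mul _ (Finset.measurable_sum _ fun j _ => hm j),
              lintegral_finsetSum _ fun j _ => hm j]
        _ ≤ _ := by
            gcongr with j hj
            refine (H.le j (fun x => b j x ^ r) (fun x y hxy => by simp only [hb j hxy])).trans ?_
            gcongr with x
            by_cases hx : x ∈ e j
            · rw [Set.indicator_of_mem hx]
              gcongr
              calc b j x = (e j).indicator (b j) x := (Set.indicator_of_mem hx _).symm
                _ ≤ _ := ENNReal.le_tsum j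
            · rw [Set.indicator_of_notMem hx]
              exact zero_le
  have step : ∫⁻ x, B n x ^ r ∂μ ≤
      K * ∫⁻ x, ENNReal.ofReal r * (G x * B n x ^ (r - 1)) ∂μ := by
    refine H.lintegral_le_of_tsum
      (φ := fun j x => if j < n then ENNReal.ofReal r * (b j x * B (j + 1) x ^ (r - 1)) else 0)
      (fun j x y hxy => ?_) (fun x => ?_) (fun x => ?_)
    · have h1 := H.factors_sum hb (le_refl (j + 1)) hxy
      simp only at h1
      simp only [hB, h1, hb j hxy]
    · have : ∀ m ≤ n, B m x ^ r ≤ ∑ j ∈ Finset.range m,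
          (if j < n then ENNReal.ofReal r * (b j x * B (j + 1) x ^ (r - 1)) else 0) := by
        intro m
        induction m with
        | zero => simp [hB, ENNReal.zero_rpow_of_pos h0]
        | succ m ih =>
          intro hm
          rw [Finset.sum_range_succ, if_pos (by omega), hBs]
          refine (add_rpow_le_add_mul h1 (hBfin m x) (hfin m x)).trans ?_
          gcongr
          exact ih (by omega)
      exact (this n le_rfl).trans (ENNReal.sum_le_tsum _)
    · rw [hG, ← ENNReal.tsum_mul_right, ← ENNReal.tsum_mul_left]
      refine ENNReal.tsum_le_tsum fun j => ?_
      by_cases hx : x ∈ e j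
      · rw [Set.indicator_of_mem hx, Set.indicator_of_mem hx]
        split_ifs with hj
        · have : B (j + 1) x ≤ B n x := hBmono x hj
          have : 0 ≤ r - 1 := by linarith
          gcongr
        · exact zero_le
      · rw [Set.indicator_of_notMem hx]
        exact zero_le
  have hconj : r.HolderConjugate (r / (r - 1)) := Real.HolderConjugate.conjExponent h1'
  have holder := ENNReal.lintegral_mul_le_Lp_mul_Lq μ hconj hGm.aemeasurable
    ((hBm n).pow_const (r - 1)).aemeasurable
  simp only [Pi.mul_apply] at holder
  have hr1 : 0 < r - 1 := by linarith
  have e1 : ∀ x, (B n x ^ (r - 1)) ^ (r / (r - 1)) = B n x ^ r := fun x => by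
    rw [← ENNReal.rpow_mul]
    congr 1
    field_simp
  simp_rw [e1] at holder
  set I := ∫⁻ x, B n x ^ r ∂μ with hI
  set J := ∫⁻ x, G x ^ r ∂μ with hJ
  have est : I ≤ ENNReal.ofReal r * K * J ^ (1 / r) * I ^ (1 / (r / (r - 1))) := by
    calc I ≤ K * ∫⁻ x, ENNReal.ofReal r * (G x * B n x ^ (r - 1)) ∂μ := step
      _ = ENNReal.ofReal r * K * ∫⁻ x, G x * B n x ^ (r - 1) ∂μ := by
          rw [lintegral_const_mul _ (f := fun x => G x * B n x ^ (r - 1))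
            (hGm.mul ((hBm n).pow_const _))]
          ring
      _ ≤ ENNReal.ofReal r * K * (J ^ (1 / r) * I ^ (1 / (r / (r - 1)))) := by gcongr
      _ = _ := by ring
  rcases eq_or_ne I 0 with hI0 | hI0
  · rw [hI0]
    exact zero_le
  have hsplit : I = I ^ (1 / r) * I ^ (1 / (r / (r - 1))) := by
    rw [← ENNReal.rpow_add _ _ hI0 hfinB]
    have : 1 / r + 1 / (r / (r - 1)) = 1 := by
      field_simp
      ring
    rw [this, ENNReal.rpow_one]
  -- Divide by `I ^ (1 / r')` with `r' = r / (r - 1)`, which is neither zero nor infinite.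
  have hcancel : I ^ (1 / r) ≤ ENNReal.ofReal r * K * J ^ (1 / r) := by
    rw [hsplit] at est
    have hne0 : I ^ (1 / (r / (r - 1))) ≠ 0 :=
      (ENNReal.rpow_pos (pos_iff_ne_zero.2 hI0) hfinB).ne'
    have hnet : I ^ (1 / (r / (r - 1))) ≠ ⊤ :=
      ENNReal.rpow_ne_top_of_nonneg (by positivity) hfinB
    have est' : I ^ (1 / r) * I ^ (1 / (r / (r - 1))) ≤
      ENNReal.ofReal r * K * J ^ (1 / r) * I ^ (1 / (r / (r - 1))) := by
      rw [← hsplit] at est ⊢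
      exact est
    exact (ENNReal.mul_le_mul_iff_left hne0 hnet).1 est'
  calc I = (I ^ (1 / r)) ^ r := by
        rw [← ENNReal.rpow_mul, one_div_mul_cancel h0.ne', ENNReal.rpow_one]
    _ ≤ (ENNReal.ofReal r * K * J ^ (1 / r)) ^ r := by gcongr
    _ = _ := by
        rw [ENNReal.mul_rpow_of_nonneg _ _ h0.le, ← ENNReal.rpow_mul, one_div_mul_cancel h0.ne',
          ENNReal.rpow_one]

/-- For `r ≥ 1` the bound on partial sums is uniform in `n`, so monotone convergence applies; the
sum of the two constants covers both ranges of `r`. -/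
lemma lintegral_tsum_rpow_le (H : LevelSystem μ κ e K) {b : ℕ → α → ℝ≥0∞}
    (hb : ∀ j, Function.FactorsThrough (b j) (κ j)) (hfin : ∀ j x, b j x ≠ ⊤) {r : ℝ}
    (h0 : 0 < r) (hK : K ≠ ⊤) :
    ∫⁻ x, (∑' j, b j x) ^ r ∂μ ≤
      (K + (ENNReal.ofReal r * K) ^ r) * ∫⁻ x, (∑' j, (e j).indicator (b j) x) ^ r ∂μ := by
  rcases le_total r 1 with h1 | h1
  · refine (H.lintegral_tsum_rpow_le_of_le_one hb hfin h0 h1).trans ?_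
    gcongr
    exact le_self_add
  · have hm : ∀ n, Measurable fun x => (∑ j ∈ Finset.range n, b j x) ^ r := fun n =>
      (Finset.measurable_sum _ fun j _ => H.meas j _ (hb j)).pow_const r
    have hmono : Monotone fun n x => (∑ j ∈ Finset.range n, b j x) ^ r := by
      intro n m hnm x
      refine ENNReal.rpow_le_rpow (Finset.sum_le_sum_of_subset ?_) h0.le
      simpa using hnm
    calc _ ≤ ∫⁻ x, ⨆ n, (∑ j ∈ Finset.range n, b j x) ^ r ∂μ := by
          gcongr with x
          have ht : Tendsto (fun n => (∑ j ∈ Finset.range n, b j x) ^ r) atTop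
              (𝓝 ((∑' j, b j x) ^ r)) :=
            (ENNReal.continuous_rpow_const.tendsto _).comp (ENNReal.tendsto_nat_tsum _)
          exact le_of_tendsto' ht fun n => le_iSup (fun n => (∑ j ∈ Finset.range n, b j x) ^ r) n
      _ = ⨆ n, ∫⁻ x, (∑ j ∈ Finset.range n, b j x) ^ r ∂μ := lintegral_iSup hm hmono
      _ ≤ (ENNReal.ofReal r * K) ^ r * ∫⁻ x, (∑' j, (e j).indicator (b j) x) ^ r ∂μ :=
          iSup_le fun n => H.lintegral_sum_rpow_le_of_one_le hb hfin h1 hK n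
      _ ≤ _ := by
          gcongr
          exact le_add_self

/-- In a level system the cells may be replaced by their intersections with the sets `e j`. -/
lemma exists_lintegral_lnorm_le {q : ℝ≥0∞} (hq : 0 < q) {p : ℝ} (hp : 0 < p) (hK : K ≠ ⊤) :
    ∃ C : ℝ≥0∞, C ≠ ⊤ ∧ ∀ e : ℕ → Set α, LevelSystem μ κ e K → ∀ b : ℕ → α → ℝ≥0∞,
      (∀ j, Function.FactorsThrough (b j) (κ j)) → (∀ j x, b j x ≠ ⊤) →
      ∫⁻ x, lnorm q (fun j => b j x) ^ p ∂μ ≤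
        C * ∫⁻ x, lnorm q (fun j => (e j).indicator (b j) x) ^ p ∂μ := by
  by_cases hqt : q = ⊤
  · subst hqt
    refine ⟨K, hK, fun e H b hb _ => ?_⟩
    have key := H.lintegral_iSup_le (b := fun j x => b j x ^ p)
      (fun j x y hxy => by simp only [hb j hxy])
    have hpow : ∀ f : ℕ → ℝ≥0∞, (⨆ j, f j) ^ p = ⨆ j, f j ^ p := fun f =>
      (ENNReal.orderIsoRpow p hp).map_iSup f
    simp_rw [lnorm_top, hpow]
    refine key.trans_eq ?_
    congr 2 with x
    congr 1 with j
    by_cases hx : x ∈ e j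
    · simp [hx]
    · simp [hx, ENNReal.zero_rpow_of_pos hp]
  · have hqp : 0 < q.toReal := ENNReal.toReal_pos hq.ne' hqt
    have hr : 0 < p / q.toReal := by positivity
    refine ⟨K + (ENNReal.ofReal (p / q.toReal) * K) ^ (p / q.toReal), ?_, fun e H b hb hfin => ?_⟩
    · exact ENNReal.add_ne_top.2 ⟨hK, ENNReal.rpow_ne_top_of_nonneg hr.le
        (ENNReal.mul_ne_top ENNReal.ofReal_ne_top hK)⟩
    -- Passing to `q`-th powers turns the quasi-norm into a sum and leaves the outer exponent `p /
    -- q`.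
    have key := H.lintegral_tsum_rpow_le (b := fun j x => b j x ^ q.toReal)
      (fun j x y hxy => by simp only [hb j hxy])
      (fun j x => ENNReal.rpow_ne_top_of_nonneg hqp.le (hfin j x)) hr hK
    simp_rw [lnorm_of_ne_top hqt, ← ENNReal.rpow_mul, one_div_mul_eq_div]
    refine key.trans_eq ?_
    congr 2 with x
    congr 2 with j
    by_cases hx : x ∈ e j
    · simp [hx]
    · simp [hx, ENNReal.zero_rpow_of_pos hqp]

end LevelSystem

end Levels

/-! ### Local Muckenhoupt weights and dyadic cubes -/

section Weights

variable {d : ℕ} {w : EuclideanSpace ℝ (Fin d) → ℝ}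

lemma IsLocMuckenhoupt.aemeasurable {r : ℝ} (hw : IsLocMuckenhoupt d r w) :
    AEMeasurable (fun x => ENNReal.ofReal (w x)) volume :=
  hw.2.1.aestronglyMeasurable.aemeasurable.ennreal_ofReal

/-- Portions of a small ball have comparable weight. -/
lemma IsLocMuckenhoupt.exists_ball_le {r : ℝ} (hr : 1 < r) (hw : IsLocMuckenhoupt d r w) :
    ∃ C : ℝ≥0∞, C ≠ ⊤ ∧ ∀ (c : EuclideanSpace ℝ (Fin d)) (ρ : ℝ), 0 < ρ →
      volume (Metric.ball c ρ) ≤ 1 → ∀ A ⊆ Metric.ball c ρ, MeasurableSet A → ∀ N : ℝ≥0∞,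
      volume (Metric.ball c ρ) ≤ N * volume A →
      (volume.withDensity fun x => ENNReal.ofReal (w x)) (Metric.ball c ρ) ≤
        (C * N) ^ r * (volume.withDensity fun x => ENNReal.ofReal (w x)) A := by
  obtain ⟨C, hC⟩ := hw.2.2.2
  refine ⟨C, ENNReal.coe_ne_top, fun c ρ hρ hV A hA hAm N hN => ?_⟩
  have hr0 : 0 < r := by linarith
  have hr1 : 0 < r - 1 := by linarith
  set v : EuclideanSpace ℝ (Fin d) → ℝ≥0∞ := fun x => ENNReal.ofReal (w x) with hv
  have hvm : AEMeasurable v volume := hw.aemeasurable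
  rw [withDensity_apply _ hAm, withDensity_apply _ Metric.isOpen_ball.measurableSet]
  have hC' := hC c ρ hρ hV
  set B := Metric.ball c ρ with hB
  set V := volume B with hVdef
  have hV0 : V ≠ 0 := (Metric.measure_ball_pos volume c hρ).ne'
  have hVt : V ≠ ⊤ := ne_top_of_le_ne_top ENNReal.one_ne_top hV
  set D := ∫⁻ x in B, v x ^ (-(r / (r - 1)) / r) with hD
  have hconj : r.HolderConjugate (r / (r - 1)) := Real.HolderConjugate.conjExponent hr
  have hexp : 1 / r + 1 / (r / (r - 1)) = 1 := by
    field_simp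
    ring
  -- The Muckenhoupt condition with integrals in place of averages: the powers of the volume
  -- multiply to `V` since `1 / r + 1 / r' = 1`.
  have h1 : (∫⁻ x in B, v x) ^ (1 / r) * D ^ (1 / (r / (r - 1))) ≤ C * V := by
    have e : ∀ I : ℝ≥0∞, I = V * (V⁻¹ * I) := fun I => by
      rw [← mul_assoc, ENNReal.mul_inv_cancel hV0 hVt, one_mul]
    calc _ = (V * (V⁻¹ * ∫⁻ x in B, v x)) ^ (1 / r) * (V * (V⁻¹ * D)) ^ (1 / (r / (r - 1))) := by
          rw [← e, ← e]
      _ = (V ^ (1 / r) * V ^ (1 / (r / (r - 1)))) * ((V⁻¹ * ∫⁻ x in B, v x) ^ (1 / r) *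
            (V⁻¹ * D) ^ (1 / (r / (r - 1)))) := by
          rw [ENNReal.mul_rpow_of_nonneg V (V⁻¹ * ∫⁻ x in B, v x) (by positivity),
            ENNReal.mul_rpow_of_nonneg V (V⁻¹ * D) (by positivity)]
          ring
      _ ≤ V * C := by
          rw [← ENNReal.rpow_add _ _ hV0 hVt, hexp, ENNReal.rpow_one]
          gcongr
      _ = _ := mul_comm _ _
  -- Hölder's inequality for `1 = v ^ (1 / r) * v ^ (-(1 / r))`; almost everywhere positivity of the
  -- weight enters here.
  have h2 : volume A ≤ (∫⁻ x in A, v x) ^ (1 / r) * D ^ (1 / (r / (r - 1))) := by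
    have hvA : AEMeasurable v (volume.restrict A) := hvm.restrict
    have := ENNReal.lintegral_mul_le_Lp_mul_Lq (volume.restrict A) hconj
      (hvA.pow_const (1 / r)) (hvA.pow_const (-(1 / r)))
    simp only [Pi.mul_apply, ← ENNReal.rpow_mul] at this
    calc volume A = ∫⁻ x in A, 1 := by simp
      _ = ∫⁻ x in A, v x ^ (1 / r) * v x ^ (-(1 / r)) := by
          refine lintegral_congr_ae ?_
          filter_upwards [ae_restrict_of_ae hw.2.2.1] with x hx
          rw [← ENNReal.rpow_add _ _ (by simpa [hv] using hx) (by simp [hv]), add_neg_cancel,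
            ENNReal.rpow_zero]
      _ ≤ _ := this
      _ ≤ _ := by
          rw [one_div_mul_cancel hr0.ne', show -(1 / r) * (r / (r - 1)) = -(r / (r - 1)) / r by ring]
          simp only [ENNReal.rpow_one]
          gcongr
          exact lintegral_mono_set hA
  have h3 : V * (∫⁻ x in B, v x) ^ (1 / r) ≤ V * (C * N * (∫⁻ x in A, v x) ^ (1 / r)) := by
    calc _ ≤ (N * volume A) * (∫⁻ x in B, v x) ^ (1 / r) := by gcongr
      _ ≤ (N * ((∫⁻ x in A, v x) ^ (1 / r) * D ^ (1 / (r / (r - 1))))) *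
            (∫⁻ x in B, v x) ^ (1 / r) := by gcongr
      _ = N * (∫⁻ x in A, v x) ^ (1 / r) * ((∫⁻ x in B, v x) ^ (1 / r) *
            D ^ (1 / (r / (r - 1)))) := by ring
      _ ≤ N * (∫⁻ x in A, v x) ^ (1 / r) * (C * V) := by gcongr
      _ = _ := by ring
  have h4 := (ENNReal.mul_le_mul_iff_right hV0 hVt).1 h3
  calc ∫⁻ x in B, v x = ((∫⁻ x in B, v x) ^ (1 / r)) ^ r := by
        rw [← ENNReal.rpow_mul, one_div_mul_cancel hr0.ne', ENNReal.rpow_one]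
    _ ≤ (C * N * (∫⁻ x in A, v x) ^ (1 / r)) ^ r := by gcongr
    _ = _ := by
        rw [ENNReal.mul_rpow_of_nonneg _ _ hr0.le, ← ENNReal.rpow_mul, one_div_mul_cancel hr0.ne',
          ENNReal.rpow_one]

lemma volume_ball_eq (x : EuclideanSpace ℝ (Fin d)) {ρ : ℝ} (hρ : 0 < ρ) :
    volume (Metric.ball x ρ) =
      ENNReal.ofReal (ρ ^ d) * volume (Metric.ball (0 : EuclideanSpace ℝ (Fin d)) 1) := by
  rw [Measure.addHaar_ball_of_pos _ _ hρ, finrank_euclideanSpace_fin]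

/-- Balls of the same small radius with overlapping halves have comparable weight. -/
lemma IsLocMuckenhoupt.exists_chain_le {r : ℝ} (hr : 1 < r) (hw : IsLocMuckenhoupt d r w) :
    ∃ D : ℝ≥0∞, D ≠ ⊤ ∧ ∀ ρ : ℝ, 0 < ρ →
      volume (Metric.ball (0 : EuclideanSpace ℝ (Fin d)) ρ) ≤ 1 →
      ∀ (n : ℕ) (x y : EuclideanSpace ℝ (Fin d)), dist x y ≤ n * ρ →
      (volume.withDensity fun x => ENNReal.ofReal (w x)) (Metric.ball x ρ) ≤
        D ^ n * (volume.withDensity fun x => ENNReal.ofReal (w x)) (Metric.ball y ρ) := by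
  obtain ⟨C, hC, h⟩ := hw.exists_ball_le hr
  have hr0 : 0 ≤ r := by linarith
  set D := (C * ENNReal.ofReal (2 ^ d)) ^ r
  have hstep : ∀ ρ : ℝ, 0 < ρ → volume (Metric.ball (0 : EuclideanSpace ℝ (Fin d)) ρ) ≤ 1 →
      ∀ x y : EuclideanSpace ℝ (Fin d), dist x y ≤ ρ →
      (volume.withDensity fun x => ENNReal.ofReal (w x)) (Metric.ball x ρ) ≤
        D * (volume.withDensity fun x => ENNReal.ofReal (w x)) (Metric.ball y ρ) := by
    intro ρ hρ hV x y hxy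
    -- The ball of half the radius about the midpoint lies in both balls and has `2 ^ (-d)` of their
    -- volume.
    have hsub : ∀ a b : EuclideanSpace ℝ (Fin d), dist a b ≤ ρ →
        Metric.ball (midpoint ℝ a b) (ρ / 2) ⊆ Metric.ball a ρ := fun a b hab => by
      apply Metric.ball_subset_ball'
      rw [dist_midpoint_left]
      norm_num
      linarith
    have hm : volume (Metric.ball x ρ) ≤
        ENNReal.ofReal (2 ^ d) * volume (Metric.ball (midpoint ℝ x y) (ρ / 2)) := by
      rw [volume_ball_eq x hρ, volume_ball_eq _ (half_pos hρ), ← mul_assoc,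
        ← ENNReal.ofReal_mul (by positivity), ← mul_pow, mul_div_cancel₀ ρ two_ne_zero]
    refine (h x ρ hρ (by rwa [volume_ball_eq _ hρ, ← volume_ball_eq 0 hρ]) _ (hsub x y hxy)
      Metric.isOpen_ball.measurableSet _ hm).trans ?_
    gcongr
    rw [midpoint_comm]
    exact hsub y x (by rwa [dist_comm])
  refine ⟨D, ENNReal.rpow_ne_top_of_nonneg hr0 (ENNReal.mul_ne_top hC ENNReal.ofReal_ne_top),
    fun ρ hρ hV n => ?_⟩
  induction n with
  | zero =>
    intro x y hxy
    have : x = y := by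
      rw [← dist_le_zero]
      simpa using hxy
    simp [this]
  | succ n ih =>
    intro x y hxy
    -- The first of `n + 1` equal steps from `x` to `y`.
    set z := AffineMap.lineMap (k := ℝ) x y (1 / ((n : ℝ) + 1)) with hz
    have hn : (0 : ℝ) < n + 1 := by positivity
    push_cast at hxy
    have h1 : dist x z ≤ ρ := by
      rw [hz, dist_left_lineMap, Real.norm_of_nonneg (by positivity), div_mul_eq_mul_div, one_mul,
        div_le_iff₀ hn]
      linarith
    have h2 : dist z y ≤ n * ρ := by
      have e : (1 : ℝ) - 1 / (n + 1) = n / (n + 1) := by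
        field_simp
        ring
      rw [hz, dist_lineMap_right, e, Real.norm_of_nonneg (by positivity), div_mul_eq_mul_div,
        div_le_iff₀ hn]
      have : (n : ℝ) * dist x y ≤ n * ((n + 1) * ρ) := by gcongr
      linarith
    calc _ ≤ D * _ := hstep ρ hρ hV x z h1
      _ ≤ D * (D ^ n * _) := by
          gcongr
          exact ih z y h2
      _ = _ := by ring

/-- The index of the dyadic cube of generation `j` that contains a point. -/
noncomputable def cubeIndex (d j : ℕ) (x : EuclideanSpace ℝ (Fin d)) : Fin d → ℤ :=
  fun l => ⌊x l * 2 ^ j⌋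

lemma mem_dyadicCube {j : ℕ} {k : Fin d → ℤ} {x : EuclideanSpace ℝ (Fin d)} :
    x ∈ dyadicCube d j k ↔ cubeIndex d j x = k := by
  have h2 : (0 : ℝ) < 2 ^ j := by positivity
  simp only [dyadicCube, Set.mem_ofPred_eq, cubeIndex, funext_iff]
  refine forall_congr' fun l => ?_
  rw [Int.floor_eq_iff, Real.rpow_neg zero_le_two, Real.rpow_natCast, inv_mul_le_iff₀ h2,
    lt_inv_mul_iff₀ h2, mul_comm]

lemma measurable_cubeIndex (j : ℕ) : Measurable (cubeIndex d j) := by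
  refine measurable_pi_lambda _ fun l => Int.measurable_floor.comp ?_
  fun_prop

lemma measurableSet_dyadicCube (j : ℕ) (k : Fin d → ℤ) : MeasurableSet (dyadicCube d j k) := by
  have : dyadicCube d j k = cubeIndex d j ⁻¹' {k} := by
    ext x
    simp [mem_dyadicCube]
  rw [this]
  exact measurable_cubeIndex j (MeasurableSet.singleton k)

/-- The coarse index is the integer quotient of the fine index by `2 ^ m`, with `m = j - i`. -/
lemma cubeIndex_nested (i j : ℕ) (hij : i ≤ j) :
    Function.FactorsThrough (cubeIndex d i) (cubeIndex d j) := by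
  obtain ⟨m, rfl⟩ := Nat.exists_eq_add_of_le hij
  have key : ∀ t : ℝ, ⌊t * 2 ^ i⌋ = ⌊t * 2 ^ (i + m)⌋ / (2 ^ m : ℤ) := by
    intro t
    have := Int.floor_div_natCast (t * 2 ^ (i + m)) (2 ^ m)
    push_cast at this
    rw [← this]
    congr 1
    rw [pow_add]
    field_simp
  intro x y hxy
  ext l
  have := congrFun hxy l
  simp only [cubeIndex] at this ⊢
  rw [key, key, this]

lemma volume_dyadicCube (j : ℕ) (k : Fin d → ℤ) :
    volume (dyadicCube d j k) = ENNReal.ofReal (((2 : ℝ) ^ j)⁻¹ ^ d) := by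
  have h : dyadicCube d j k = (MeasurableEquiv.toLp 2 (Fin d → ℝ)).symm ⁻¹' (Set.univ.pi fun l =>
      Set.Ico ((2 : ℝ) ^ (-(j : ℝ)) * (k l : ℝ)) ((2 : ℝ) ^ (-(j : ℝ)) * ((k l : ℝ) + 1))) := by
    ext x
    simp [dyadicCube]
  rw [h, (EuclideanSpace.volume_preserving_symm_measurableEquiv_toLp (Fin d)).measure_preimage
    (MeasurableSet.univ_pi fun _ => measurableSet_Ico).nullMeasurableSet, Real.volume_pi_Ico]
  simp only [mul_add, mul_one, add_sub_cancel_left, Finset.prod_const, Finset.card_univ,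
    Fintype.card_fin]
  rw [Real.rpow_neg zero_le_two, Real.rpow_natCast, ENNReal.ofReal_pow (by positivity)]

/-- Large portions of dyadic cubes of side length at most one have comparable weight. -/
lemma IsLocMuckenhoupt.exists_dyadicCube_le (hd : 1 ≤ d) {r : ℝ} (hr : 1 < r)
    (hw : IsLocMuckenhoupt d r w) :
    ∃ K : ℝ≥0∞, K ≠ ⊤ ∧ ∀ (j : ℕ) (k : Fin d → ℤ) (A : Set (EuclideanSpace ℝ (Fin d))),
      MeasurableSet A → volume (dyadicCube d j k) ≤ 2 * volume (A ∩ dyadicCube d j k) →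
      (volume.withDensity fun x => ENNReal.ofReal (w x)) (dyadicCube d j k) ≤
        K * (volume.withDensity fun x => ENNReal.ofReal (w x)) (A ∩ dyadicCube d j k) := by
  obtain ⟨C, hC, hball⟩ := hw.exists_ball_le hr
  obtain ⟨D, hD, hchain⟩ := hw.exists_chain_le hr
  set ν := volume.withDensity fun x => ENNReal.ofReal (w x) with hν
  -- With `β` the volume of the unit ball, `ρ = 1 / (1 + β)` works: since `ρ' ≤ 1` and `d ≥ 1`, the
  -- volume `ρ' ^ d * β` is at most `ρ' * β`.
  obtain ⟨ρ, hρ, hρV⟩ : ∃ ρ : ℝ, 0 < ρ ∧ ∀ ρ' : ℝ, 0 < ρ' → ρ' ≤ ρ →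
      volume (Metric.ball (0 : EuclideanSpace ℝ (Fin d)) ρ') ≤ 1 := by
    set β := (volume (Metric.ball (0 : EuclideanSpace ℝ (Fin d)) 1)).toReal with hβ
    have hβ0 : 0 ≤ β := ENNReal.toReal_nonneg
    refine ⟨1 / (1 + β), by positivity, fun ρ' h0 h1 => ?_⟩
    have hle : ρ' ≤ 1 := h1.trans (by rw [div_le_one (by positivity)]; linarith)
    rw [volume_ball_eq _ h0, ← ENNReal.ofReal_toReal (a := volume (Metric.ball _ _))
      measure_ball_lt_top.ne, ← hβ, ← ENNReal.ofReal_mul (by positivity), ENNReal.ofReal_le_one]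
    calc ρ' ^ d * β ≤ ρ' ^ 1 * β := by
          gcongr ?_ * β
          exact pow_le_pow_of_le_one h0.le hle hd
      _ ≤ 1 / (1 + β) * (1 + β) := by
          rw [pow_one]
          gcongr
          linarith
      _ = 1 := by field_simp
  set U : Set (EuclideanSpace ℝ (Fin d)) := dyadicCube d 0 0 with hU
  have hUb : Bornology.IsBounded U := by
    have : U ⊆ Metric.closedBall 0 (Real.sqrt d) := by
      intro x hx
      rw [mem_closedBall_zero_iff, EuclideanSpace.norm_eq]
      apply Real.sqrt_le_sqrt
      calc ∑ i, ‖x i‖ ^ 2 ≤ ∑ i : Fin d, (1 : ℝ) := by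
            refine Finset.sum_le_sum fun i _ => ?_
            have := hx i
            simp at this
            rw [Real.norm_of_nonneg this.1]
            nlinarith
        _ = d := by simp
    exact Metric.isBounded_closedBall.subset this
  -- The unit cube is covered once and for all by finitely many balls. Scaling and translating this
  -- cover serves every dyadic cube, so the number of balls and the length `N` of chains between
  -- centres do not depend on the cube.
  obtain ⟨t, ht, hUt⟩ := Metric.totallyBounded_iff.1
    (hUb.isCompact_closure.totallyBounded.subset subset_closure) ρ hρ
  lift t to Finset (EuclideanSpace ℝ (Fin d)) using ht
  obtain ⟨N, hN⟩ : ∃ N : ℕ, ∀ a ∈ t, ∀ b ∈ t, dist a b ≤ N * ρ := by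
    obtain ⟨R, hR⟩ := Metric.isBounded_iff.1 t.finite_toSet.isBounded
    obtain ⟨N, hN⟩ := exists_nat_ge (R / ρ)
    exact ⟨N, fun a ha b hb => (hR ha hb).trans ((div_le_iff₀ hρ).1 hN)⟩
  set n : ℝ≥0∞ := (t.card : ℝ≥0∞) with hn
  set β := volume (Metric.ball (0 : EuclideanSpace ℝ (Fin d)) ρ) with hβ
  have hβ1 : β ≤ 1 := hρV ρ hρ le_rfl
  -- The weight of the cube is at most that of `n` balls, each compared along a chain of at most `N`
  -- steps with one ball that catches an `n`-th of the portion `A`. As `A` fills half of the cube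
  -- and `β ≤ 1`, that ball has volume at most `2 * n` times the volume of what it catches.
  refine ⟨n * (D ^ N * (C * (2 * n)) ^ r), ?_, fun j k A hA hQ => ?_⟩
  · have hn' : n ≠ ⊤ := ENNReal.natCast_ne_top _
    refine ENNReal.mul_ne_top hn' (ENNReal.mul_ne_top (ENNReal.pow_ne_top hD)
      (ENNReal.rpow_ne_top_of_nonneg (by linarith) ?_))
    exact ENNReal.mul_ne_top hC (ENNReal.mul_ne_top (by simp) hn')
  set δ : ℝ := ((2 : ℝ) ^ j)⁻¹ with hδ
  have hδ0 : 0 < δ := by positivity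
  have hδ1 : δ ≤ 1 := inv_le_one_of_one_le₀ (one_le_pow₀ one_le_two)
  have hδρ : 0 < δ * ρ := by positivity
  set kk : EuclideanSpace ℝ (Fin d) := WithLp.toLp 2 fun l => (k l : ℝ) with hkk
  set B : EuclideanSpace ℝ (Fin d) → Set (EuclideanSpace ℝ (Fin d)) :=
    fun a => Metric.ball (δ • (kk + a)) (δ * ρ) with hB
  have hQB : dyadicCube d j k ⊆ ⋃ a ∈ t, B a := by
    intro x hx
    have hy : δ⁻¹ • x - kk ∈ U := by
      rw [mem_dyadicCube] at hx ⊢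
      ext l
      have := congrFun hx l
      simp only [cubeIndex] at this
      have e : (δ⁻¹ • x - kk) l = x l * 2 ^ j - (k l : ℝ) := by
        simp [hδ, hkk, mul_comm]
      simp only [cubeIndex, e, pow_zero, mul_one, Int.floor_sub_intCast, this, Pi.zero_apply,
        sub_self]
    have := hUt hy
    simp only [Set.mem_iUnion, Finset.mem_coe, exists_prop] at this ⊢
    obtain ⟨a, ha, hya⟩ := this
    refine ⟨a, ha, ?_⟩
    rw [Metric.mem_ball] at hya
    have e : x = δ • (kk + (δ⁻¹ • x - kk)) := by
      rw [add_sub_cancel, smul_smul, mul_inv_cancel₀ hδ0.ne', one_smul]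
    rw [hB, Metric.mem_ball, e, dist_smul₀, dist_add_left, Real.norm_of_nonneg hδ0.le]
    gcongr
  have hBvol : ∀ a, volume (B a) = β * volume (dyadicCube d j k) := by
    intro a
    rw [hB, hβ, volume_dyadicCube, volume_ball_eq _ hδρ, volume_ball_eq _ hρ, mul_pow,
      ENNReal.ofReal_mul (by positivity)]
    ring
  have hBV1 : volume (Metric.ball (0 : EuclideanSpace ℝ (Fin d)) (δ * ρ)) ≤ 1 :=
    hρV _ hδρ (by nlinarith)
  have htne : t.Nonempty := by
    rw [Finset.nonempty_iff_ne_empty]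
    rintro rfl
    have h0 : (WithLp.toLp 2 fun _ => 0 : EuclideanSpace ℝ (Fin d)) ∈ U := by
      rw [mem_dyadicCube]
      ext l
      simp [cubeIndex]
    simpa using hUt h0
  -- Pigeonhole over the cover.
  obtain ⟨a, hat, ha⟩ : ∃ a ∈ t, volume (A ∩ dyadicCube d j k) ≤
      n * volume (A ∩ dyadicCube d j k ∩ B a) := by
    obtain ⟨a, ha, hmax⟩ := t.exists_max_image
      (fun a => volume (A ∩ dyadicCube d j k ∩ B a)) htne
    refine ⟨a, ha, ?_⟩
    calc volume (A ∩ dyadicCube d j k) ≤ ∑ a ∈ t, volume (A ∩ dyadicCube d j k ∩ B a) := by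
          refine (measure_mono ?_).trans (measure_biUnion_finset_le t _)
          intro x hx
          have := hQB hx.2
          simp only [Set.mem_iUnion, exists_prop] at this ⊢
          obtain ⟨a, ha, hxa⟩ := this
          exact ⟨a, ha, hx, hxa⟩
      _ ≤ t.card • volume (A ∩ dyadicCube d j k ∩ B a) := Finset.sum_le_card_nsmul _ _ _ hmax
      _ = _ := by rw [nsmul_eq_mul]
  have hBa : ν (B a) ≤ (C * (2 * n)) ^ r * ν (A ∩ dyadicCube d j k) := by
    refine (hball _ _ hδρ (by rwa [volume_ball_eq _ hδρ, ← volume_ball_eq 0 hδρ]) _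
      (Set.inter_subset_right (s := A ∩ dyadicCube d j k))
      ((hA.inter (measurableSet_dyadicCube j k)).inter Metric.isOpen_ball.measurableSet)
      (2 * n) ?_).trans ?_
    · calc volume (B a) = β * volume (dyadicCube d j k) := hBvol a
        _ ≤ 1 * (2 * (n * volume (A ∩ dyadicCube d j k ∩ B a))) := by
            gcongr
            exact hQ.trans (by gcongr)
        _ = _ := by ring
    · exact mul_le_mul_right (measure_mono Set.inter_subset_left) _
  calc ν (dyadicCube d j k) ≤ ∑ b ∈ t, ν (B b) :=
        (measure_mono hQB).trans (measure_biUnion_finset_le t _)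
    _ ≤ ∑ _b ∈ t, D ^ N * ν (B a) := by
        refine Finset.sum_le_sum fun b hb => hchain _ hδρ hBV1 N _ _ ?_
        rw [dist_smul₀, dist_add_left, Real.norm_of_nonneg hδ0.le]
        calc δ * dist b a ≤ δ * (N * ρ) := by
              gcongr
              exact hN b hb a hat
          _ = _ := by ring
    _ = n * (D ^ N * ν (B a)) := by rw [Finset.sum_const, nsmul_eq_mul]
    _ ≤ n * (D ^ N * ((C * (2 * n)) ^ r * ν (A ∩ dyadicCube d j k))) := by gcongr
    _ = _ := by ring

end Weights

/-! ### The sequence spaces in terms of levels -/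

section Levels

variable {d : ℕ}

lemma measurable_lnorm {α : Type*} [MeasurableSpace α] {q : ℝ≥0∞} {f : ℕ → α → ℝ≥0∞}
    (hf : ∀ j, Measurable (f j)) : Measurable fun x => lnorm q fun j => f j x := by
  by_cases hq : q = ⊤
  · subst hq
    simp_rw [lnorm_top]
    exact Measurable.iSup hf
  · simp_rw [lnorm_of_ne_top hq]
    exact (Measurable.tsum fun j => (hf j).pow_const _).pow_const _

lemma lnorm_zero {ι : Type*} {q : ℝ≥0∞} (hq : 0 < q) : lnorm q (fun _ : ι => 0) = 0 := by
  simpa using lnorm_const_mul hq 0 (fun _ : ι => 0)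

/-- The weighted coefficient `2^(s j) |a_{j,k}|`. -/
noncomputable def coeff (s : ℝ) (a : ℕ × (Fin d → ℤ) → ℂ) (i : ℕ × (Fin d → ℤ)) : ℝ≥0∞ :=
  (2 : ℝ≥0∞) ^ (s * (i.1 : ℝ)) * ‖a i‖ₑ

lemma two_rpow_ne_zero (t : ℝ) : (2 : ℝ≥0∞) ^ t ≠ 0 :=
  (ENNReal.rpow_pos (by simp) (by simp)).ne'

lemma two_rpow_ne_top (t : ℝ) : (2 : ℝ≥0∞) ^ t ≠ ⊤ :=
  ENNReal.rpow_ne_top_of_ne_zero (by simp) (by simp)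

lemma coeff_ne_top (s : ℝ) (a : ℕ × (Fin d → ℤ) → ℂ) (i : ℕ × (Fin d → ℤ)) :
    coeff s a i ≠ ⊤ :=
  ENNReal.mul_ne_top (two_rpow_ne_top _) enorm_ne_top

lemma coeff_eq_zero {s : ℝ} {a : ℕ × (Fin d → ℤ) → ℂ} {i : ℕ × (Fin d → ℤ)} :
    coeff s a i = 0 ↔ a i = 0 := by
  simp [coeff]

/-- Every family of finite nonnegative numbers is the family of coefficients of a sequence. -/
lemma exists_coeff_eq (s : ℝ) (b : ℕ × (Fin d → ℤ) → ℝ≥0∞) (hb : ∀ i, b i ≠ ⊤) :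
    ∃ a : ℕ × (Fin d → ℤ) → ℂ, ∀ i, coeff s a i = b i := by
  refine ⟨fun i => ((((2 : ℝ≥0∞) ^ (s * (i.1 : ℝ)))⁻¹ * b i).toReal : ℂ), fun i => ?_⟩
  have h : ((2 : ℝ≥0∞) ^ (s * (i.1 : ℝ)))⁻¹ * b i ≠ ⊤ :=
    ENNReal.mul_ne_top (ENNReal.inv_ne_top.2 (two_rpow_ne_zero _)) (hb i)
  rw [coeff, ← ofReal_norm, Complex.norm_real,
    Real.norm_of_nonneg ENNReal.toReal_nonneg, ENNReal.ofReal_toReal h, ← mul_assoc,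
    ENNReal.mul_inv_cancel (two_rpow_ne_zero _) (two_rpow_ne_top _), one_mul]

lemma fFun_eq_lnorm_fTerm (s : ℝ) (q : ℝ≥0∞) (a : ℕ × (Fin d → ℤ) → ℂ)
    (x : EuclideanSpace ℝ (Fin d)) : fFun d s q a x = lnorm q (fTerm d s a x) := rfl

lemma fTerm_eq (s : ℝ) (a : ℕ × (Fin d → ℤ) → ℂ) (x : EuclideanSpace ℝ (Fin d)) (j : ℕ)
    (k : Fin d → ℤ) [Decidable (k = cubeIndex d j x)] :
    fTerm d s a x (j, k) = if k = cubeIndex d j x then coeff s a (j, k) else 0 := by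
  split_ifs with h
  · simp [fTerm, coeff, Set.indicator_of_mem (mem_dyadicCube.2 h.symm)]
  · simp [fTerm, Set.indicator_of_notMem (fun hx => h (mem_dyadicCube.1 hx).symm)]

/-- Only one cube of each generation contributes at a given point. -/
lemma fFun_eq {s : ℝ} {q : ℝ≥0∞} (hq : 0 < q) (a : ℕ × (Fin d → ℤ) → ℂ)
    (x : EuclideanSpace ℝ (Fin d)) :
    fFun d s q a x = lnorm q fun j => coeff s a (j, cubeIndex d j x) := by
  classical
  rw [fFun_eq_lnorm_fTerm]
  by_cases hqt : q = ⊤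
  · subst hqt
    rw [lnorm_top, lnorm_top, iSup_prod]
    congr 1 with j
    refine le_antisymm (iSup_le fun k => ?_) ?_
    · rw [fTerm_eq]
      split_ifs with h
      · rw [h]
      · exact zero_le
    · refine le_iSup_of_le (cubeIndex d j x) ?_
      rw [fTerm_eq, if_pos rfl]
  · have hqp : 0 < q.toReal := ENNReal.toReal_pos hq.ne' hqt
    rw [lnorm_of_ne_top hqt, lnorm_of_ne_top hqt, ENNReal.tsum_prod']
    congr 2 with j
    rw [tsum_eq_single (cubeIndex d j x), fTerm_eq, if_pos rfl]
    intro k hk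
    rw [fTerm_eq, if_neg hk, ENNReal.zero_rpow_of_pos hqp]

lemma measurable_comp_cubeIndex (f : ℕ × (Fin d → ℤ) → ℝ≥0∞) (j : ℕ) :
    Measurable fun x => f (j, cubeIndex d j x) :=
  (Measurable.of_discrete (f := fun k => f (j, k))).comp (measurable_cubeIndex j)

lemma measurable_fFun {s : ℝ} {q : ℝ≥0∞} (hq : 0 < q) (a : ℕ × (Fin d → ℤ) → ℂ) :
    Measurable (fFun d s q a) := by
  simp_rw [funext fun x => fFun_eq (s := s) hq a x]
  exact measurable_lnorm fun j => measurable_comp_cubeIndex _ j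

/-- Subsets that fill a fixed portion of each dyadic cube form a level system for every measure
for which such subsets of cubes are large. -/
lemma levelSystem_cubeIndex {ν : Measure (EuclideanSpace ℝ (Fin d))} {K : ℝ≥0∞}
    (hν : ∀ (j : ℕ) (k : Fin d → ℤ) (A : Set (EuclideanSpace ℝ (Fin d))),
      MeasurableSet A → volume (dyadicCube d j k) ≤ 2 * volume (A ∩ dyadicCube d j k) →
      ν (dyadicCube d j k) ≤ K * ν (A ∩ dyadicCube d j k))
    {e : ℕ → Set (EuclideanSpace ℝ (Fin d))} (he : ∀ j, MeasurableSet (e j))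
    (hvol : ∀ j k, volume (dyadicCube d j k) ≤ 2 * volume (e j ∩ dyadicCube d j k)) :
    LevelSystem ν (cubeIndex d) e K where
  nested := cubeIndex_nested
  meas j h hh := by
    obtain ⟨g, rfl⟩ := (Function.factorsThrough_iff h).1 hh
    exact (Measurable.of_discrete (f := g)).comp (measurable_cubeIndex j)
  measSet := he
  le j h hh := by
    obtain ⟨g, rfl⟩ := (Function.factorsThrough_iff h).1 hh
    have hg : Measurable g := Measurable.of_discrete
    have hm := measurable_cubeIndex (d := d) j
    have hpre : ∀ k, cubeIndex d j ⁻¹' {k} = dyadicCube d j k := fun k => by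
      ext x
      simp [mem_dyadicCube]
    rw [lintegral_indicator (he j)]
    simp only [Function.comp_apply]
    -- Pushed forward to the countable set of indices, both integrals become sums over cubes that
    -- are compared term by term.
    rw [← lintegral_map hg hm, ← lintegral_map hg hm, lintegral_countable', lintegral_countable',
      ← ENNReal.tsum_mul_left]
    refine ENNReal.tsum_le_tsum fun k => ?_
    rw [Measure.map_apply hm (MeasurableSet.singleton k),
      Measure.map_apply hm (MeasurableSet.singleton k), hpre,
      Measure.restrict_apply (measurableSet_dyadicCube j k), Set.inter_comm]
    calc _ ≤ g k * (K * ν (e j ∩ dyadicCube d j k)) := by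
          gcongr
          exact hν j k _ (he j) (hvol j k)
      _ = _ := by ring

/-- An almost everywhere positive and finite function has an approximate median. -/
lemma exists_median {α : Type*} [MeasurableSpace α] (μ : Measure α) [IsFiniteMeasure μ]
    {u : α → ℝ≥0∞} (hu : Measurable u) (h0 : ∀ᵐ x ∂μ, u x ≠ 0) (ht : ∀ᵐ x ∂μ, u x ≠ ⊤) :
    ∃ m : ℝ≥0∞, m ≠ 0 ∧ m ≠ ⊤ ∧ μ Set.univ ≤ 2 * μ {x | u x ≤ m} ∧
      μ Set.univ ≤ 2 * μ {x | m ≤ 2 * u x} := by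
  rcases eq_or_ne (μ Set.univ) 0 with hμ | hμ
  · exact ⟨1, one_ne_zero, ENNReal.one_ne_top, by simp [hμ], by simp [hμ]⟩
  have hμt : μ Set.univ ≠ ⊤ := measure_ne_top _ _
  -- The median is sought among the powers of two. Almost everywhere finiteness of `u` makes large
  -- `k` admissible, positivity rules out very negative `k`, so a least admissible `k` exists.
  set P : ℤ → Prop := fun k => μ Set.univ ≤ 2 * μ {x | u x ≤ (2 : ℝ≥0∞) ^ (k : ℝ)} with hP
  have hms : ∀ t : ℝ≥0∞, MeasurableSet {x | u x ≤ t} := fun t => measurableSet_le hu measurable_const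
  have hmono : ∀ k l : ℤ, k ≤ l → P k → P l := by
    intro k l hkl hk
    have hle : (2 : ℝ≥0∞) ^ (k : ℝ) ≤ 2 ^ (l : ℝ) :=
      ENNReal.rpow_le_rpow_of_exponent_le one_le_two (by exact_mod_cast hkl)
    exact hk.trans (mul_le_mul_right (measure_mono fun x hx => le_trans hx hle) 2)
  have hlarge : ∃ k, P k := by
    have hM : Monotone fun n : ℕ => {x | u x ≤ (2 : ℝ≥0∞) ^ n} := fun n m hnm x hx =>
      le_trans hx (pow_le_pow_right₀ (one_le_two (α := ℝ≥0∞)) hnm)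
    have hT := tendsto_measure_iUnion_atTop (μ := μ) hM
    have hU : μ (⋃ n : ℕ, {x | u x ≤ (2 : ℝ≥0∞) ^ n}) = μ Set.univ := by
      refine measure_congr (eventuallyEq_univ.2 ?_)
      filter_upwards [ht] with x hx
      obtain ⟨n, hn⟩ := ENNReal.exists_nat_gt hx
      refine Set.mem_iUnion.2 ⟨n, hn.le.trans ?_⟩
      exact_mod_cast Nat.lt_two_pow_self.le
    rw [hU] at hT
    obtain ⟨n, hn⟩ := (hT.eventually (lt_mem_nhds (ENNReal.half_lt_self hμ hμt))).exists
    refine ⟨n, ?_⟩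
    simp only [hP, Int.cast_natCast, ENNReal.rpow_natCast]
    rw [mul_comm]
    exact (ENNReal.div_le_iff (by simp) (by simp)).1 hn.le
  have hsmall : ∃ b, ∀ k, P k → b ≤ k := by
    have hM : Antitone fun n : ℕ => {x | u x ≤ (2 : ℝ≥0∞)⁻¹ ^ n} := fun n m hnm x hx =>
      le_trans hx (pow_le_pow_right_of_le_one'
        (ENNReal.inv_le_one.2 (one_le_two (α := ℝ≥0∞))) hnm)
    have hT := tendsto_measure_iInter_atTop (μ := μ) (fun n => (hms _).nullMeasurableSet) hM
      ⟨0, measure_ne_top _ _⟩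
    have hU : μ (⋂ n : ℕ, {x | u x ≤ (2 : ℝ≥0∞)⁻¹ ^ n}) = 0 := by
      refine measure_mono_null ?_ h0
      intro x hx hx0
      obtain ⟨n, hn⟩ := ENNReal.exists_inv_two_pow_lt hx0
      exact absurd (Set.mem_iInter.1 hx n) (not_le.2 hn)
    rw [hU] at hT
    obtain ⟨n, hn⟩ := (hT.eventually (gt_mem_nhds (ENNReal.half_pos hμ))).exists
    refine ⟨-n, fun k hk => ?_⟩
    by_contra hlt
    have hPn := hmono k (-n) (by omega) hk
    simp only [hP, Int.cast_neg, Int.cast_natCast, ENNReal.rpow_neg, ENNReal.rpow_natCast,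
      ENNReal.inv_pow] at hPn
    rw [mul_comm, ← ENNReal.div_le_iff (by simp) (by simp)] at hPn
    exact absurd hPn (not_le.2 hn)
  obtain ⟨k, hk, hmin⟩ := Int.exists_least_of_bdd hsmall hlarge
  refine ⟨(2 : ℝ≥0∞) ^ (k : ℝ), two_rpow_ne_zero _, two_rpow_ne_top _, hk, ?_⟩
  -- By minimality `u > 2 ^ (k - 1)` on more than half of the space; this one step down is the
  -- factor two in the claim.
  have hnot : ¬ P (k - 1) := fun h => by
    have := hmin _ h
    omega
  simp only [hP, not_le] at hnot
  have hsub : {x | u x ≤ (2 : ℝ≥0∞) ^ ((k - 1 : ℤ) : ℝ)}ᶜ ⊆ {x | (2 : ℝ≥0∞) ^ (k : ℝ) ≤ 2 * u x} := by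
    intro x hx
    simp only [Set.mem_compl_iff, Set.mem_ofPred_eq, not_le] at hx ⊢
    calc (2 : ℝ≥0∞) ^ (k : ℝ) = 2 * 2 ^ ((k - 1 : ℤ) : ℝ) := by
          nth_rewrite 2 [← ENNReal.rpow_one 2]
          rw [← ENNReal.rpow_add _ _ (by simp) (by simp)]
          congr 1
          push_cast
          ring
      _ ≤ _ := by gcongr
  have hadd := measure_add_measure_compl (μ := μ) (hms ((2 : ℝ≥0∞) ^ ((k - 1 : ℤ) : ℝ)))
  have h2 : μ Set.univ + μ Set.univ ≤ μ Set.univ + 2 * μ {x | (2 : ℝ≥0∞) ^ (k : ℝ) ≤ 2 * u x} := by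
    calc μ Set.univ + μ Set.univ = 2 * μ {x | u x ≤ (2 : ℝ≥0∞) ^ ((k - 1 : ℤ) : ℝ)} +
          2 * μ {x | u x ≤ (2 : ℝ≥0∞) ^ ((k - 1 : ℤ) : ℝ)}ᶜ := by
          rw [← mul_add, hadd, two_mul]
      _ ≤ _ := by gcongr
  exact (ENNReal.add_le_add_iff_left hμt).1 h2

end Levels

/-! ### Factorization -/

section Factorization

variable {d : ℕ}

/-- The exponential function with values in the extended nonnegative numbers. -/
noncomputable def expE (t : ℝ) : ℝ≥0∞ := ENNReal.ofReal (Real.exp t)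

lemma expE_ne_zero (t : ℝ) : expE t ≠ 0 := by simp [expE, Real.exp_pos]

lemma expE_ne_top (t : ℝ) : expE t ≠ ⊤ := ENNReal.ofReal_ne_top

lemma exists_expE {x : ℝ≥0∞} (h0 : x ≠ 0) (ht : x ≠ ⊤) : ∃ t, x = expE t := by
  refine ⟨Real.log x.toReal, ?_⟩
  rw [expE, Real.exp_log (ENNReal.toReal_pos h0 ht), ENNReal.ofReal_toReal ht]

lemma expE_rpow (t c : ℝ) : expE t ^ c = expE (t * c) := by
  rw [expE, ENNReal.ofReal_rpow_of_pos (Real.exp_pos t), expE, Real.exp_mul]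

lemma expE_mul (s t : ℝ) : expE s * expE t = expE (s + t) := by
  rw [expE, expE, ← ENNReal.ofReal_mul (Real.exp_pos s).le, expE, Real.exp_add]

lemma expE_inv (t : ℝ) : (expE t)⁻¹ = expE (-t) := by
  rw [expE, expE, Real.exp_neg, ENNReal.ofReal_inv_of_pos (Real.exp_pos t)]

lemma expE_div (s t : ℝ) : expE s / expE t = expE (s - t) := by
  rw [div_eq_mul_inv, expE_inv, expE_mul, sub_eq_add_neg]

lemma lintegral_withDensity' {v : EuclideanSpace ℝ (Fin d) → ℝ≥0∞} (hv : Measurable v)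
    {g : EuclideanSpace ℝ (Fin d) → ℝ≥0∞} (hg : Measurable g) :
    ∫⁻ x, g x ∂(volume.withDensity v) = ∫⁻ x, g x * v x := by
  rw [lintegral_withDensity_eq_lintegral_mul _ hv hg]
  simp only [Pi.mul_apply, mul_comm]

/-- The property of a weight that large portions of dyadic cubes have comparable weight. -/
def DyadicLarge (v : EuclideanSpace ℝ (Fin d) → ℝ≥0∞) (K : ℝ≥0∞) : Prop :=
  ∀ (j : ℕ) (k : Fin d → ℤ) (A : Set (EuclideanSpace ℝ (Fin d))),
    MeasurableSet A → volume (dyadicCube d j k) ≤ 2 * volume (A ∩ dyadicCube d j k) →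
    volume.withDensity v (dyadicCube d j k) ≤ K * volume.withDensity v (A ∩ dyadicCube d j k)

/-- One factor: coefficients `a ^ θ * m` whose multipliers are dominated on large portions of cubes
by a suitable function `u` give a sequence in the factor space. -/
lemma exists_factor {q' : ℝ≥0∞} (hq' : 0 < q') {p' : ℝ} (hp' : 0 < p')
    {v' : EuclideanSpace ℝ (Fin d) → ℝ≥0∞} (hv' : Measurable v') {K : ℝ≥0∞} (hK : K ≠ ⊤)
    (hvK : DyadicLarge v' K) (L : ℝ≥0∞) (hL : L ≠ ⊤) :
    ∃ C : ℝ≥0∞, C ≠ ⊤ ∧ ∀ (s s' p θ : ℝ) (q : ℝ≥0∞) (v : EuclideanSpace ℝ (Fin d) → ℝ≥0∞)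
      (_ : 0 < q) (_ : 0 ≤ θ)
      (_ : q' = ⊤ ∨ (q' ≠ ⊤ ∧ q ≠ ⊤ ∧ θ * q'.toReal = q.toReal))
      (a : ℕ × (Fin d → ℤ) → ℂ) (m : ℕ × (Fin d → ℤ) → ℝ≥0∞) (_ : ∀ i, m i ≠ ⊤)
      (e : ℕ → Set (EuclideanSpace ℝ (Fin d))) (_ : ∀ j, MeasurableSet (e j))
      (_ : ∀ j k, volume (dyadicCube d j k) ≤ 2 * volume (e j ∩ dyadicCube d j k))
      (u : EuclideanSpace ℝ (Fin d) → ℝ≥0∞)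
      (_ : ∀ j x, x ∈ e j → a (j, cubeIndex d j x) ≠ 0 → m (j, cubeIndex d j x) ≤ L * u x)
      (_ : ∀ᵐ x, fFun d s q a x ≠ 0 →
        (fFun d s q a x ^ θ * u x) ^ p' * v' x ≤ fFun d s q a x ^ p * v x),
      ∃ a' : ℕ × (Fin d → ℤ) → ℂ, (∀ i, a i ≠ 0 → coeff s' a' i = coeff s a i ^ θ * m i) ∧
        ∫⁻ x, fFun d s' q' a' x ^ p' * v' x ≤ C * ∫⁻ x, fFun d s q a x ^ p * v x := by
  obtain ⟨C, hC, hCle⟩ := LevelSystem.exists_lintegral_lnorm_le (μ := volume.withDensity v')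
    (κ := cubeIndex d) hq' hp' hK
  refine ⟨C * L ^ p', ENNReal.mul_ne_top hC (ENNReal.rpow_ne_top_of_nonneg hp'.le hL), ?_⟩
  intro s s' p θ q v hq hθ hqq a m hm e he hvol u hmu hFu
  classical
  -- The exponent `θ` may be zero when `q' = ⊤`, and then `0 ^ θ = 1`; vanishing coefficients
  -- therefore have to be kept at zero separately.
  set b : ℕ × (Fin d → ℤ) → ℝ≥0∞ := fun i => if a i = 0 then 0 else coeff s a i ^ θ * m i with hb
  have hbt : ∀ i, b i ≠ ⊤ := fun i => by
    simp only [hb]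
    split_ifs
    · simp
    · exact ENNReal.mul_ne_top (ENNReal.rpow_ne_top_of_nonneg hθ (coeff_ne_top s a i)) (hm i)
  obtain ⟨a', ha'⟩ := exists_coeff_eq s' b hbt
  refine ⟨a', fun i hi => ?_, ?_⟩
  · rw [ha']
    simp [hb, hi]
  have H := levelSystem_cubeIndex hvK he hvol
  set g : ℕ → EuclideanSpace ℝ (Fin d) → ℝ≥0∞ := fun j x => b (j, cubeIndex d j x) with hg
  have hgm : ∀ j, Measurable (g j) := fun j => measurable_comp_cubeIndex b j
  have hF' : ∀ x, fFun d s' q' a' x = lnorm q' fun j => g j x := fun x => by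
    rw [fFun_eq hq']
    simp only [ha', hg]
  -- From here on the cubes of level `j` count only through `e j`, where `m` is controlled by `u`.
  have key := hCle e H g (fun j x y hxy => by simp only [hg, hxy]) (fun j x => hbt _)
  rw [lintegral_withDensity' hv' ((measurable_lnorm hgm).pow_const p'),
    lintegral_withDensity' hv'
      ((measurable_lnorm fun j => (hgm j).indicator (he j)).pow_const p')] at key
  simp_rw [hF']
  refine key.trans ?_
  rw [mul_assoc, ← lintegral_const_mul' _ _ (ENNReal.rpow_ne_top_of_nonneg hp'.le hL)]
  refine mul_le_mul_right (lintegral_mono_ae ?_) C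
  filter_upwards [hFu] with x hx
  by_cases hF0 : fFun d s q a x = 0
  · have h0 : ∀ j, (e j).indicator (g j) x = 0 := fun j => by
      have hc : coeff s a (j, cubeIndex d j x) = 0 := by
        rw [fFun_eq hq] at hF0
        refine le_antisymm ?_ zero_le
        rw [← hF0]
        exact le_lnorm hq (fun j => coeff s a (j, cubeIndex d j x)) j
      have : g j x = 0 := by
        simp [hg, hb, coeff_eq_zero.1 hc]
      by_cases hxe : x ∈ e j
      · rw [Set.indicator_of_mem hxe, this]
      · rw [Set.indicator_of_notMem hxe]
    simp_rw [h0]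
    rw [lnorm_zero hq', ENNReal.zero_rpow_of_pos hp', zero_mul]
    exact zero_le
  · have h1 : lnorm q' (fun j => (e j).indicator (g j) x) ≤ L * (fFun d s q a x ^ θ * u x) := by
      calc _ ≤ lnorm q' (fun j => (L * u x) * coeff s a (j, cubeIndex d j x) ^ θ) := by
            refine lnorm_mono fun j => ?_
            by_cases hxe : x ∈ e j
            · rw [Set.indicator_of_mem hxe]
              simp only [hg, hb]
              split_ifs with h0
              · exact zero_le
              · rw [mul_comm]
                gcongr
                exact hmu j x hxe h0
            · rw [Set.indicator_of_notMem hxe]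
              exact zero_le
        _ = (L * u x) * lnorm q' (fun j => coeff s a (j, cubeIndex d j x) ^ θ) :=
            lnorm_const_mul hq' _ _
        _ ≤ (L * u x) * fFun d s q a x ^ θ := by
            rw [fFun_eq hq]
            gcongr
            exact lnorm_rpow_le hq hq' hθ hqq _
        _ = _ := by ring
    calc _ ≤ (L * (fFun d s q a x ^ θ * u x)) ^ p' * v' x := by gcongr
      _ = L ^ p' * ((fFun d s q a x ^ θ * u x) ^ p' * v' x) := by
          rw [ENNReal.mul_rpow_of_nonneg _ _ hp'.le, mul_assoc]
      _ ≤ _ := by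
          exact mul_le_mul_right (hx hF0) _

/-- The exponents by which the `ℓ_q` quasi-norm is distributed over the factors. -/
lemma exists_exponents {Θ : ℝ} (h0 : 0 < Θ) (h1 : Θ < 1) {q q₀ q₁ : ℝ≥0∞} (hq₀ : 0 < q₀)
    (hq₁ : 0 < q₁) (hq : 1 / q = ENNReal.ofReal (1 - Θ) / q₀ + ENNReal.ofReal Θ / q₁) :
    0 < q ∧ ∃ θ₀ θ₁ : ℝ, 0 ≤ θ₀ ∧ 0 ≤ θ₁ ∧ (1 - Θ) * θ₀ + Θ * θ₁ = 1 ∧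
      (q₀ = ⊤ ∨ (q₀ ≠ ⊤ ∧ q ≠ ⊤ ∧ θ₀ * q₀.toReal = q.toReal)) ∧
      (q₁ = ⊤ ∨ (q₁ ≠ ⊤ ∧ q ≠ ⊤ ∧ θ₁ * q₁.toReal = q.toReal)) := by
  have hΘ : 0 < 1 - Θ := by linarith
  have f₀ : ENNReal.ofReal (1 - Θ) / q₀ ≠ ⊤ := ENNReal.div_ne_top ENNReal.ofReal_ne_top hq₀.ne'
  have f₁ : ENNReal.ofReal Θ / q₁ ≠ ⊤ := ENNReal.div_ne_top ENNReal.ofReal_ne_top hq₁.ne'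
  have hqpos : 0 < q := by
    rw [pos_iff_ne_zero]
    rintro rfl
    have := ENNReal.add_ne_top.2 ⟨f₀, f₁⟩
    rw [← hq] at this
    simp at this
  refine ⟨hqpos, ?_⟩
  by_cases hqt : q = ⊤
  · subst hqt
    rw [ENNReal.div_top] at hq
    obtain ⟨e₀, e₁⟩ := add_eq_zero.1 hq.symm
    have t₀ : q₀ = ⊤ := by
      rcases ENNReal.div_eq_zero_iff.1 e₀ with h | h
      · exact absurd h (by simpa using h1)
      · exact h
    have t₁ : q₁ = ⊤ := by
      rcases ENNReal.div_eq_zero_iff.1 e₁ with h | h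
      · exact absurd h (by simpa using h0)
      · exact h
    exact ⟨1, 1, zero_le_one, zero_le_one, by ring, Or.inl t₀, Or.inl t₁⟩
  · have hqp : 0 < q.toReal := ENNReal.toReal_pos hqpos.ne' hqt
    have hreal : 1 / q.toReal = (1 - Θ) / q₀.toReal + Θ / q₁.toReal := by
      have := congrArg ENNReal.toReal hq
      rwa [ENNReal.toReal_add f₀ f₁, ENNReal.toReal_div, ENNReal.toReal_div,
        ENNReal.toReal_div, ENNReal.toReal_ofReal hΘ.le, ENNReal.toReal_ofReal h0.le,
        ENNReal.toReal_one] at this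
    have hcase : ∀ q' : ℝ≥0∞, 0 < q' → q' = ⊤ ∨ (q' ≠ ⊤ ∧ q ≠ ⊤ ∧
        q.toReal / q'.toReal * q'.toReal = q.toReal) := fun q' hq' => by
      by_cases h : q' = ⊤
      · exact Or.inl h
      · exact Or.inr ⟨h, hqt, div_mul_cancel₀ _ (ENNReal.toReal_pos hq'.ne' h).ne'⟩
    -- For an infinite `q₀` or `q₁` this quotient is zero by the convention for division, as
    -- required.
    refine ⟨q.toReal / q₀.toReal, q.toReal / q₁.toReal, by positivity, by positivity, ?_,
      hcase q₀ hq₀, hcase q₁ hq₁⟩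
    have : q.toReal * (1 / q.toReal) = 1 := mul_one_div_cancel hqp.ne'
    linear_combination this - q.toReal * hreal

/-- Sequences with finite quasi-norm factor with control of the quasi-norms of the factors. -/
lemma exists_factorization {Θ : ℝ} (hΘ0 : 0 < Θ) (hΘ1 : Θ < 1) {p₀ p₁ p : ℝ} (hp₀ : 0 < p₀)
    (hp₁ : 0 < p₁) (hp0 : 0 < p) (hp : 1 / p = (1 - Θ) / p₀ + Θ / p₁) {q₀ q₁ q : ℝ≥0∞}
    (hq₀ : 0 < q₀) (hq₁ : 0 < q₁)
    (hq : 1 / q = ENNReal.ofReal (1 - Θ) / q₀ + ENNReal.ofReal Θ / q₁) {s₀ s₁ s : ℝ}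
    (hs : s = (1 - Θ) * s₀ + Θ * s₁) {v₀ v₁ v : EuclideanSpace ℝ (Fin d) → ℝ≥0∞}
    (hm₀ : Measurable v₀) (hm₁ : Measurable v₁) (hz₀ : ∀ x, v₀ x ≠ 0) (hz₁ : ∀ x, v₁ x ≠ 0)
    (ht₀ : ∀ x, v₀ x ≠ ⊤) (ht₁ : ∀ x, v₁ x ≠ ⊤)
    (hv : ∀ x, v x = v₀ x ^ ((1 - Θ) * p / p₀) * v₁ x ^ (Θ * p / p₁)) {K₀ K₁ : ℝ≥0∞}
    (hK₀ : K₀ ≠ ⊤) (hK₁ : K₁ ≠ ⊤) (hD₀ : DyadicLarge v₀ K₀) (hD₁ : DyadicLarge v₁ K₁) :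
    ∃ C : ℝ≥0∞, C ≠ ⊤ ∧ ∀ a : ℕ × (Fin d → ℤ) → ℂ, ∫⁻ x, fFun d s q a x ^ p * v x ≠ ⊤ →
      ∃ a₀ a₁ : ℕ × (Fin d → ℤ) → ℂ, (∀ i, ‖a i‖ ≤ ‖a₀ i‖ ^ (1 - Θ) * ‖a₁ i‖ ^ Θ) ∧
        ∫⁻ x, fFun d s₀ q₀ a₀ x ^ p₀ * v₀ x ≤ C * ∫⁻ x, fFun d s q a x ^ p * v x ∧
        ∫⁻ x, fFun d s₁ q₁ a₁ x ^ p₁ * v₁ x ≤ C * ∫⁻ x, fFun d s q a x ^ p * v x := by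
  have hΘ : 0 < 1 - Θ := by linarith
  obtain ⟨hq0, θ₀, θ₁, hθ₀, hθ₁, hθ, hqq₀, hqq₁⟩ := exists_exponents hΘ0 hΘ1 hq₀ hq₁ hq
  -- The constant `2 ^ (1 / (1 - Θ))` is what `m ≤ 2 * u` gives for the power `1 / (1 - Θ)`; the
  -- second factor uses `u ≤ m`, which costs only `1`.
  obtain ⟨C₀, hC₀, h₀⟩ := exists_factor hq₀ hp₀ hm₀ hK₀ hD₀ (2 ^ (1 / (1 - Θ)))
    (two_rpow_ne_top _)
  obtain ⟨C₁, hC₁, h₁⟩ := exists_factor hq₁ hp₁ hm₁ hK₁ hD₁ 1 ENNReal.one_ne_top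
  refine ⟨C₀ + C₁, ENNReal.add_ne_top.2 ⟨hC₀, hC₁⟩, fun a ha => ?_⟩
  have hvm : Measurable v := by
    rw [funext hv]
    exact (hm₀.pow_const _).mul (hm₁.pow_const _)
  set F := fFun d s q a with hF
  have hFm : Measurable F := measurable_fFun hq0 a
  have hz : ∀ x, v x ≠ 0 := fun x => by
    rw [hv]
    exact mul_ne_zero (ENNReal.rpow_pos (pos_iff_ne_zero.2 (hz₀ x)) (ht₀ x)).ne'
      (ENNReal.rpow_pos (pos_iff_ne_zero.2 (hz₁ x)) (ht₁ x)).ne'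
  have hFt : ∀ᵐ x, F x ≠ ⊤ := by
    filter_upwards [ae_lt_top ((hFm.pow_const p).mul hvm) ha] with x hx hFx
    simp [hFx, ENNReal.top_rpow_of_pos hp0, ENNReal.top_mul (hz x)] at hx
  -- The ideal multiplier: `F ^ θ₀ * u ^ (1 / (1 - Θ))` is `F ^ (p / p₀) * (v / v₀) ^ (1 / p₀)`,
  -- whose `p₀`-th power times `v₀` is `F ^ p * v`. Where `F` is positive and finite, the relations
  -- between the exponents make `u` equal to `(F ^ (p / p₁ - θ₁) * (v / v₁) ^ (1 / p₁)) ^ (-Θ)` as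
  -- well, so `u ^ (-(1 / Θ))` suits the second factor.
  set u : EuclideanSpace ℝ (Fin d) → ℝ≥0∞ :=
    fun x => (F x ^ (p / p₀ - θ₀) * (v x / v₀ x) ^ (1 / p₀)) ^ (1 - Θ) with hu
  have hum : Measurable u :=
    (((hFm.pow_const _).mul ((hvm.div hm₀).pow_const _)).pow_const _)
  have hcF : ∀ j x, coeff s a (j, cubeIndex d j x) ≤ F x := fun j x => by
    rw [hF, fFun_eq hq0]
    exact le_lnorm hq0 (fun j => coeff s a (j, cubeIndex d j x)) j
  have hpp : p * ((1 - Θ) / p₀ + Θ / p₁) = 1 := by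
    rw [← hp, mul_one_div_cancel hp0.ne']
  -- In logarithms the identities between products of powers become linear.
  have hlocal : ∀ x, F x ≠ 0 → F x ≠ ⊤ → ∃ f b₀ b₁ : ℝ, F x = expE f ∧ v₀ x = expE b₀ ∧
      v₁ x = expE b₁ ∧ v x = expE (b₀ * ((1 - Θ) * p / p₀) + b₁ * (Θ * p / p₁)) ∧
      u x = expE ((f * (p / p₀ - θ₀) + (b₀ * ((1 - Θ) * p / p₀) + b₁ * (Θ * p / p₁) - b₀) *
        (1 / p₀)) * (1 - Θ)) := by
    intro x hx0 hxt
    obtain ⟨f, hf⟩ := exists_expE hx0 hxt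
    obtain ⟨b₀, hb₀⟩ := exists_expE (hz₀ x) (ht₀ x)
    obtain ⟨b₁, hb₁⟩ := exists_expE (hz₁ x) (ht₁ x)
    have hvx : v x = expE (b₀ * ((1 - Θ) * p / p₀) + b₁ * (Θ * p / p₁)) := by
      rw [hv, hb₀, hb₁, expE_rpow, expE_rpow, expE_mul]
    refine ⟨f, b₀, b₁, hf, hb₀, hb₁, hvx, ?_⟩
    simp only [hu]
    rw [hf, hvx, hb₀, expE_div, expE_rpow, expE_rpow, expE_mul, expE_rpow]
  -- On a cube with `a i ≠ 0` the function `F` is bounded below by a positive coefficient, so `u` is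
  -- positive and finite almost everywhere there and has a median. Elsewhere `m` is arbitrary.
  have hmed : ∀ i : ℕ × (Fin d → ℤ), ∃ m : ℝ≥0∞, m ≠ 0 ∧ m ≠ ⊤ ∧ (a i ≠ 0 →
      volume (dyadicCube d i.1 i.2) ≤ 2 * volume ({x | u x ≤ m} ∩ dyadicCube d i.1 i.2) ∧
      volume (dyadicCube d i.1 i.2) ≤ 2 * volume ({x | m ≤ 2 * u x} ∩ dyadicCube d i.1 i.2)) := by
    rintro ⟨j, k⟩
    by_cases hi : a (j, k) = 0
    · exact ⟨1, one_ne_zero, ENNReal.one_ne_top, fun h => absurd hi h⟩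
    have : IsFiniteMeasure (volume.restrict (dyadicCube d j k)) :=
      ⟨by rw [Measure.restrict_apply_univ, volume_dyadicCube]; exact ENNReal.ofReal_lt_top⟩
    have hgood : ∀ᵐ x ∂(volume.restrict (dyadicCube d j k)), F x ≠ 0 ∧ F x ≠ ⊤ := by
      rw [ae_restrict_iff' (measurableSet_dyadicCube j k)]
      filter_upwards [hFt] with x hx hxQ
      refine ⟨fun h => hi ?_, hx⟩
      have := hcF j x
      rw [mem_dyadicCube.1 hxQ, h] at this
      exact coeff_eq_zero.1 (le_antisymm this zero_le)
    obtain ⟨m, hm0, hmt, h1, h2⟩ := exists_median (volume.restrict (dyadicCube d j k)) hum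
      (by
        filter_upwards [hgood] with x hx
        obtain ⟨f, b₀, b₁, -, -, -, -, h⟩ := hlocal x hx.1 hx.2
        rw [h]
        exact expE_ne_zero _)
      (by
        filter_upwards [hgood] with x hx
        obtain ⟨f, b₀, b₁, -, -, -, -, h⟩ := hlocal x hx.1 hx.2
        rw [h]
        exact expE_ne_top _)
    refine ⟨m, hm0, hmt, fun _ => ?_⟩
    rw [Measure.restrict_apply_univ,
      Measure.restrict_apply (measurableSet_le hum measurable_const)] at h1
    rw [Measure.restrict_apply_univ,
      Measure.restrict_apply (measurableSet_le measurable_const (hum.const_mul 2))] at h2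
    exact ⟨h1, h2⟩
  choose m hm0 hmt hmQ using hmed
  have hzero : ∀ j, MeasurableSet {x : EuclideanSpace ℝ (Fin d) | a (j, cubeIndex d j x) = 0} :=
    fun j => (measurable_cubeIndex j) (MeasurableSet.of_discrete (s := {k | a (j, k) = 0}))
  -- Cubes with zero coefficient carry no information on the median and are included whole in the
  -- portions.
  have hfill : ∀ (j : ℕ) (k : Fin d → ℤ) (S T : Set (EuclideanSpace ℝ (Fin d))),
      (a (j, k) ≠ 0 → volume (dyadicCube d j k) ≤ 2 * volume (S ∩ dyadicCube d j k)) →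
      S ∩ dyadicCube d j k ⊆ T →
      volume (dyadicCube d j k) ≤
        2 * volume (({x | a (j, cubeIndex d j x) = 0} ∪ T) ∩ dyadicCube d j k) := by
    intro j k S T hS hST
    by_cases hi : a (j, k) = 0
    · have : dyadicCube d j k ⊆
          ({x | a (j, cubeIndex d j x) = 0} ∪ T) ∩ dyadicCube d j k := fun x hx => by
        refine ⟨Or.inl ?_, hx⟩
        change a (j, cubeIndex d j x) = 0
        rw [mem_dyadicCube.1 hx, hi]
      refine (measure_mono this).trans ?_
      rw [two_mul]
      exact le_self_add
    · refine (hS hi).trans (mul_le_mul_right (measure_mono fun x hx => ?_) 2)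
      exact ⟨Or.inr (hST hx), hx.2⟩
  obtain ⟨a₀, ha₀, hI₀⟩ := h₀ s s₀ p θ₀ q v hq0 hθ₀ hqq₀ a
    (fun i => m i ^ (1 / (1 - Θ)))
    (fun i => ENNReal.rpow_ne_top_of_nonneg (by positivity) (hmt i))
    (fun j => {x | a (j, cubeIndex d j x) = 0} ∪ {x | m (j, cubeIndex d j x) ≤ 2 * u x})
    (fun j => (hzero j).union
      (measurableSet_le (measurable_comp_cubeIndex m j) (hum.const_mul 2)))
    (fun j k => hfill j k {x | m (j, k) ≤ 2 * u x} _ (fun h => (hmQ (j, k) h).2) (by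
      rintro x ⟨hx, hxQ⟩
      change m (j, cubeIndex d j x) ≤ 2 * u x
      rw [mem_dyadicCube.1 hxQ]
      exact hx))
    (fun x => u x ^ (1 / (1 - Θ)))
    (fun j x hx h0 => by
      have hx' : m (j, cubeIndex d j x) ≤ 2 * u x := hx.resolve_left h0
      rw [← ENNReal.mul_rpow_of_nonneg _ _ (by positivity)]
      exact ENNReal.rpow_le_rpow hx' (by positivity))
    (by
      filter_upwards [hFt] with x hxt hx0
      obtain ⟨f, b₀, b₁, hf, hb₀, hb₁, hvx, hux⟩ := hlocal x hx0 hxt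
      rw [← hF, hux, hvx, hf, hb₀]
      simp only [expE_rpow, expE_mul]
      apply le_of_eq
      congr 1
      field_simp
      ring)
  obtain ⟨a₁, ha₁, hI₁⟩ := h₁ s s₁ p θ₁ q v hq0 hθ₁ hqq₁ a
    (fun i => m i ^ (-(1 / Θ)))
    (fun i => ENNReal.rpow_ne_top_of_ne_zero (hm0 i) (hmt i))
    (fun j => {x | a (j, cubeIndex d j x) = 0} ∪ {x | u x ≤ m (j, cubeIndex d j x)})
    (fun j => (hzero j).union (measurableSet_le hum (measurable_comp_cubeIndex m j)))
    (fun j k => hfill j k {x | u x ≤ m (j, k)} _ (fun h => (hmQ (j, k) h).1) (by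
      rintro x ⟨hx, hxQ⟩
      change u x ≤ m (j, cubeIndex d j x)
      rw [mem_dyadicCube.1 hxQ]
      exact hx))
    (fun x => u x ^ (-(1 / Θ)))
    (fun j x hx h0 => by
      have hx' : u x ≤ m (j, cubeIndex d j x) := hx.resolve_left h0
      rw [one_mul, ENNReal.rpow_neg, ENNReal.rpow_neg, ENNReal.inv_le_inv]
      exact ENNReal.rpow_le_rpow hx' (by positivity))
    (by
      filter_upwards [hFt] with x hxt hx0
      obtain ⟨f, b₀, b₁, hf, hb₀, hb₁, hvx, hux⟩ := hlocal x hx0 hxt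
      rw [← hF, hux, hvx, hf, hb₁]
      simp only [expE_rpow, expE_mul]
      apply le_of_eq
      congr 1
      have e1 : (1 - Θ) * p / p₀ = 1 - Θ * p / p₁ := by linear_combination hpp
      have e2 : p / p₀ * (1 - Θ) = 1 - Θ * p / p₁ := by linear_combination hpp
      have e3 : (1 - Θ) * θ₀ = 1 - Θ * θ₁ := by linear_combination hθ
      have e4 : (1 - Θ) / p₀ = 1 / p - Θ / p₁ := by linear_combination -hp
      have : (f * (p / p₀ - θ₀) + (b₀ * ((1 - Θ) * p / p₀) + b₁ * (Θ * p / p₁) - b₀) *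
        (1 / p₀)) * (1 - Θ) = f * (p / p₀ * (1 - Θ) - (1 - Θ) * θ₀) +
          (b₀ * ((1 - Θ) * p / p₀) + b₁ * (Θ * p / p₁) - b₀) * ((1 - Θ) / p₀) := by ring
      rw [this, e2, e3, e4, e1]
      field_simp
      ring)
  refine ⟨a₀, a₁, fun i => ?_, hI₀.trans (by gcongr; exact le_self_add),
    hI₁.trans (by gcongr; exact le_add_self)⟩
  by_cases hi : a i = 0
  · rw [hi, norm_zero]
    positivity
  -- The powers of `m` cancel, and what remains is `(1 - Θ) * θ₀ + Θ * θ₁ = 1`.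
  have hEE : ‖a i‖ₑ = ‖a₀ i‖ₑ ^ (1 - Θ) * ‖a₁ i‖ₑ ^ Θ := by
    have e0 := ha₀ i hi
    have e1 := ha₁ i hi
    obtain ⟨t, ht⟩ := exists_expE (x := ‖a i‖ₑ) (by simpa using hi) enorm_ne_top
    obtain ⟨μ, hμ⟩ := exists_expE (hm0 i) (hmt i)
    have h2 : (2 : ℝ≥0∞) = expE (Real.log 2) := by
      rw [expE, Real.exp_log two_pos]
      simp
    have hsolve : ∀ (y : ℝ≥0∞) (c r : ℝ), expE c * y = expE r → y = expE (r - c) := by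
      intro y c r h
      rw [← expE_div, ← h, mul_comm, ENNReal.mul_div_cancel_right (expE_ne_zero _) (expE_ne_top _)]
    simp only [coeff, h2, ht, hμ, expE_rpow, expE_mul] at e0 e1
    rw [hsolve _ _ _ e0, hsolve _ _ _ e1, ht, expE_rpow, expE_rpow, expE_mul]
    congr 1
    have e3 : (1 - Θ) * θ₀ = 1 - Θ * θ₁ := by linear_combination hθ
    have hx1 : μ * (1 / (1 - Θ)) * (1 - Θ) = μ := by field_simp
    have hx2 : μ * -(1 / Θ) * Θ = -μ := by field_simp
    rw [hs]
    linear_combination (-(Real.log 2 * (((1 - Θ) * s₀ + Θ * s₁) * i.1) + t)) * hθ - hx1 - hx2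
  have := congrArg ENNReal.toReal hEE
  rw [ENNReal.toReal_mul, ← ENNReal.toReal_rpow, ← ENNReal.toReal_rpow] at this
  simp only [toReal_enorm] at this
  exact this.le

end Factorization

/-! ### Closures of the finite sequences -/

section Closures

variable {d : ℕ} {s p : ℝ} {q : ℝ≥0∞} {w : EuclideanSpace ℝ (Fin d) → ℝ}

lemma fTerm_mono {a b : ℕ × (Fin d → ℤ) → ℂ} (h : ∀ i, ‖a i‖ ≤ ‖b i‖)
    (x : EuclideanSpace ℝ (Fin d)) (i : ℕ × (Fin d → ℤ)) :
    fTerm d s a x i ≤ fTerm d s b x i := by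
  have : ‖a i‖ₑ ≤ ‖b i‖ₑ := by
    rw [← ofReal_norm, ← ofReal_norm]
    exact ENNReal.ofReal_le_ofReal (h i)
  unfold fTerm
  gcongr

lemma fNorm_mono (hp : 0 < p) {a b : ℕ × (Fin d → ℤ) → ℂ} (h : ∀ i, ‖a i‖ ≤ ‖b i‖) :
    fNorm d s p q w a ≤ fNorm d s p q w b := by
  have hF : ∀ x, fFun d s q a x ≤ fFun d s q b x := fun x => lnorm_mono fun i => fTerm_mono h x i
  unfold fNorm
  gcongr with x
  exact hF x

lemma fNorm_rpow (hp : 0 < p) (a : ℕ × (Fin d → ℤ) → ℂ) :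
    fNorm d s p q w a ^ p = ∫⁻ x, fFun d s q a x ^ p * ENNReal.ofReal (w x) := by
  rw [fNorm, ← ENNReal.rpow_mul, one_div_mul_cancel hp.ne', ENNReal.rpow_one]

lemma fNorm_const_mul (hq : 0 < q) (hp : 0 < p) (t : ℂ) (a : ℕ × (Fin d → ℤ) → ℂ) :
    fNorm d s p q w (fun i => t * a i) = ‖t‖ₑ * fNorm d s p q w a := by
  have hF : ∀ x, fFun d s q (fun i => t * a i) x = ‖t‖ₑ * fFun d s q a x := fun x => by
    rw [fFun_eq_lnorm_fTerm, fFun_eq_lnorm_fTerm, ← lnorm_const_mul hq]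
    congr 1 with i
    simp only [fTerm, enorm_mul]
    ring
  simp_rw [fNorm, hF, ENNReal.mul_rpow_of_nonneg _ _ hp.le, mul_assoc]
  rw [lintegral_const_mul' _ _ (ENNReal.rpow_ne_top_of_nonneg hp.le enorm_ne_top),
    ENNReal.mul_rpow_of_nonneg _ _ (by positivity), ← ENNReal.rpow_mul,
    mul_one_div_cancel hp.ne', ENNReal.rpow_one]

/-- Off the support of a finite approximant `g` the sequence `a` agrees with `a - g`, so by
monotonicity truncating `a` itself approximates at least as well. -/
lemma mem_fRing_iff (hp : 0 < p) {a : ℕ × (Fin d → ℤ) → ℂ} :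
    a ∈ (fRing d s p q w).carrier ↔ fNorm d s p q w a < ⊤ ∧ ∀ ε : ℝ≥0∞, 0 < ε →
      ∃ N : Set (ℕ × (Fin d → ℤ)), N.Finite ∧ fNorm d s p q w (Nᶜ.indicator a) < ε := by
  refine and_congr_right fun hfin => forall₂_congr fun ε hε => ⟨?_, ?_⟩
  · rintro ⟨g, -, hg, hlt⟩
    refine ⟨_, hg, (fNorm_mono hp fun i => ?_).trans_lt hlt⟩
    by_cases hi : i ∈ Function.support g
    · simp [hi]
    · have h0 : g i = 0 := by simpa using hi
      rw [Set.indicator_of_mem (by simpa using h0)]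
      simp [h0]
  · rintro ⟨N, hN, hlt⟩
    refine ⟨N.indicator a, ?_, hN.subset Set.support_indicator_subset, ?_⟩
    · refine (fNorm_mono hp fun i => ?_).trans_lt hfin
      by_cases hi : i ∈ N <;> simp [hi]
    · have : a - N.indicator a = Nᶜ.indicator a := by
        rw [Set.indicator_compl]
      rw [this]
      exact hlt

/-- Hölder's inequality for the weighted sequence spaces. -/
lemma fNorm_le_of_dominated {Θ : ℝ} (hΘ0 : 0 < Θ) (hΘ1 : Θ < 1) {p₀ p₁ : ℝ} (hp₀ : 0 < p₀)
    (hp₁ : 0 < p₁) (hp0 : 0 < p) (hp : 1 / p = (1 - Θ) / p₀ + Θ / p₁) {q₀ q₁ : ℝ≥0∞}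
    (hq0 : 0 < q) (hq₀ : 0 < q₀) (hq₁ : 0 < q₁)
    (hq : 1 / q = ENNReal.ofReal (1 - Θ) / q₀ + ENNReal.ofReal Θ / q₁) {s₀ s₁ : ℝ}
    (hs : s = (1 - Θ) * s₀ + Θ * s₁) {w₀ w₁ : EuclideanSpace ℝ (Fin d) → ℝ}
    (hm₀ : AEMeasurable (fun x => ENNReal.ofReal (w₀ x)) volume)
    (hm₁ : AEMeasurable (fun x => ENNReal.ofReal (w₁ x)) volume)
    (hw : ∀ x, ENNReal.ofReal (w x) = ENNReal.ofReal (w₀ x) ^ ((1 - Θ) * p / p₀) *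
      ENNReal.ofReal (w₁ x) ^ (Θ * p / p₁)) {a a₀ a₁ : ℕ × (Fin d → ℤ) → ℂ}
    (h : ∀ i, ‖a i‖ ≤ ‖a₀ i‖ ^ (1 - Θ) * ‖a₁ i‖ ^ Θ) :
    fNorm d s p q w a ≤ fNorm d s₀ p₀ q₀ w₀ a₀ ^ (1 - Θ) * fNorm d s₁ p₁ q₁ w₁ a₁ ^ Θ := by
  have hΘ : 0 < 1 - Θ := by linarith
  have hα : (1 - Θ) * p / p₀ + Θ * p / p₁ = 1 := by
    have : p * (1 / p) = 1 := mul_one_div_cancel hp0.ne'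
    linear_combination this - p * hp
  have hE : ∀ i, ‖a i‖ₑ ≤ ‖a₀ i‖ₑ ^ (1 - Θ) * ‖a₁ i‖ₑ ^ Θ := fun i => by
    simp only [← ofReal_norm]
    rw [ENNReal.ofReal_rpow_of_nonneg (norm_nonneg _) hΘ.le,
      ENNReal.ofReal_rpow_of_nonneg (norm_nonneg _) hΘ0.le, ← ENNReal.ofReal_mul (by positivity)]
    exact ENNReal.ofReal_le_ofReal (h i)
  have hF : ∀ x, fFun d s q a x ≤ fFun d s₀ q₀ a₀ x ^ (1 - Θ) * fFun d s₁ q₁ a₁ x ^ Θ := by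
    intro x
    rw [fFun_eq hq0, fFun_eq hq₀, fFun_eq hq₁]
    refine (lnorm_mono fun j => ?_).trans (lnorm_mul_le hq₀ hq₁ hΘ0 hΘ1 hq _ _)
    simp only [coeff]
    rw [ENNReal.mul_rpow_of_nonneg _ _ hΘ.le, ENNReal.mul_rpow_of_nonneg _ _ hΘ0.le,
      ← ENNReal.rpow_mul, ← ENNReal.rpow_mul]
    calc _ ≤ (2 : ℝ≥0∞) ^ (s * (j : ℝ)) * (‖a₀ (j, cubeIndex d j x)‖ₑ ^ (1 - Θ) *
          ‖a₁ (j, cubeIndex d j x)‖ₑ ^ Θ) := by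
          gcongr
          exact hE _
      _ = _ := by
          rw [show s * (j : ℝ) = s₀ * j * (1 - Θ) + s₁ * j * Θ by rw [hs]; ring,
            ENNReal.rpow_add _ _ (by simp) (by simp)]
          ring
  have hI : ∫⁻ x, fFun d s q a x ^ p * ENNReal.ofReal (w x) ≤
      (∫⁻ x, fFun d s₀ q₀ a₀ x ^ p₀ * ENNReal.ofReal (w₀ x)) ^ ((1 - Θ) * p / p₀) *
        (∫⁻ x, fFun d s₁ q₁ a₁ x ^ p₁ * ENNReal.ofReal (w₁ x)) ^ (Θ * p / p₁) := by
    refine le_trans (lintegral_mono fun x => ?_) (ENNReal.lintegral_mul_norm_pow_le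
      (((measurable_fFun hq₀ a₀).pow_const _).aemeasurable.mul hm₀)
      (((measurable_fFun hq₁ a₁).pow_const _).aemeasurable.mul hm₁)
      (by positivity) (by positivity) hα)
    calc _ ≤ (fFun d s₀ q₀ a₀ x ^ (1 - Θ) * fFun d s₁ q₁ a₁ x ^ Θ) ^ p *
          (ENNReal.ofReal (w₀ x) ^ ((1 - Θ) * p / p₀) *
            ENNReal.ofReal (w₁ x) ^ (Θ * p / p₁)) := by
          rw [hw]
          gcongr
          exact hF x
      _ = _ := by
          simp only [Pi.mul_apply]
          rw [ENNReal.mul_rpow_of_nonneg _ _ hp0.le,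
            ENNReal.mul_rpow_of_nonneg _ _ (by positivity : 0 ≤ (1 - Θ) * p / p₀),
            ENNReal.mul_rpow_of_nonneg _ _ (by positivity : 0 ≤ Θ * p / p₁)]
          simp only [← ENNReal.rpow_mul]
          rw [show p₀ * ((1 - Θ) * p / p₀) = (1 - Θ) * p by field_simp,
            show p₁ * (Θ * p / p₁) = Θ * p by field_simp]
          ring
  unfold fNorm
  refine (ENNReal.rpow_le_rpow hI (by positivity)).trans_eq ?_
  rw [ENNReal.mul_rpow_of_nonneg _ _ (by positivity)]
  simp only [← ENNReal.rpow_mul]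
  congr 2 <;> field_simp

lemma exists_pos_rpow_mul_lt {r : ℝ} (hr : 0 < r) {c : ℝ≥0∞} (hc : c ≠ ⊤) {ε : ℝ≥0∞} (hε : 0 < ε) :
    ∃ δ : ℝ≥0∞, 0 < δ ∧ ∀ t < δ, t ^ r * c < ε := by
  have ht : Tendsto (fun t : ℝ≥0∞ => t ^ r * c) (𝓝 0) (𝓝 0) := by
    have h1 : Tendsto (fun t : ℝ≥0∞ => t ^ r) (𝓝 0) (𝓝 0) := by
      simpa [ENNReal.zero_rpow_of_pos hr] using
        (ENNReal.continuous_rpow_const (y := r)).tendsto 0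
    simpa using ENNReal.Tendsto.mul_const h1 (Or.inr hc)
  obtain ⟨δ, hδ, h⟩ := ENNReal.nhds_zero_basis.eventually_iff.1 (ht.eventually (gt_mem_nhds hε))
  exact ⟨δ, hδ, fun t ht => h ht⟩

lemma norm_indicator_le_of_dominated {Θ : ℝ} {ι : Type*} {a a₀ a₁ : ι → ℂ}
    (h : ∀ i, ‖a i‖ ≤ ‖a₀ i‖ ^ (1 - Θ) * ‖a₁ i‖ ^ Θ) (N : Set ι) (i : ι) :
    ‖N.indicator a i‖ ≤ ‖N.indicator a₀ i‖ ^ (1 - Θ) * ‖N.indicator a₁ i‖ ^ Θ := by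
  by_cases hi : i ∈ N
  · simpa [hi] using h i
  · simp only [Set.indicator_of_notMem hi, norm_zero]
    positivity

/-! ### Countable quasi-triangle inequalities and unbounded multipliers -/

lemma iSup_rpow_le_tsum {r : ℝ} (hr : 0 < r) (b : ℕ → ℝ≥0∞) :
    (⨆ k, b k) ^ r ≤ ∑' k, b k ^ r := by
  have : (⨆ k, b k) ^ r = ⨆ k, b k ^ r := (ENNReal.orderIsoRpow r hr).map_iSup b
  rw [this]
  exact iSup_le fun k => ENNReal.le_tsum k

/-- The numbers `2 ^ (-(k + 1))` sum to one. -/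
lemma tsum_le_iSup_two_pow_mul (b : ℕ → ℝ≥0∞) : ∑' k, b k ≤ ⨆ k, 2 ^ (k + 1) * b k := by
  calc ∑' k, b k = ∑' k, (2⁻¹ : ℝ≥0∞) ^ (k + 1) * (2 ^ (k + 1) * b k) := by
        congr 1 with k
        rw [← mul_assoc, ← mul_pow, ENNReal.inv_mul_cancel (by simp) (by simp), one_pow, one_mul]
    _ ≤ ∑' k, (2⁻¹ : ℝ≥0∞) ^ (k + 1) * ⨆ k, 2 ^ (k + 1) * b k := by
        gcongr with k
        exact le_iSup (fun k => 2 ^ (k + 1) * b k) k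
    _ = _ := by
        rw [ENNReal.tsum_mul_right, ENNReal.tsum_geometric_add_one, ENNReal.one_sub_inv_two,
          inv_inv, ENNReal.inv_mul_cancel (by simp) (by simp), one_mul]

/-- Passing through a supremum treats `r < 1` and `r ≥ 1` alike. The growing weights are harmless,
since the summands will be tails chosen as small as needed. -/
lemma tsum_rpow_le {r : ℝ} (hr : 0 < r) (b : ℕ → ℝ≥0∞) :
    (∑' k, b k) ^ r ≤ ∑' k, (2 ^ (k + 1)) ^ r * b k ^ r := by
  refine (ENNReal.rpow_le_rpow (tsum_le_iSup_two_pow_mul b) hr.le).trans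
    ((iSup_rpow_le_tsum hr _).trans_eq ?_)
  simp_rw [ENNReal.mul_rpow_of_nonneg _ _ hr.le]

/-- A weighted quasi-triangle inequality for countable sums in `ℓ_q`. -/
lemma lnorm_tsum_rpow_le {ι : Type*} (hq : 0 < q) (hp : 0 < p) (z : ℕ → ι → ℝ≥0∞) :
    lnorm q (fun i => ∑' k, z k i) ^ p ≤
      ∑' k, (2 ^ (k + 1)) ^ (p / q.toReal) * (2 ^ (k + 1)) ^ p * lnorm q (z k) ^ p := by
  by_cases hqt : q = ⊤
  · subst hqt
    -- Here `p / q.toReal` is zero, so the first weight disappears.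
    simp only [ENNReal.toReal_top, div_zero, ENNReal.rpow_zero, one_mul]
    refine le_trans ?_ (tsum_rpow_le hp _)
    gcongr
    rw [lnorm_top]
    exact iSup_le fun i => ENNReal.tsum_le_tsum fun k => le_lnorm hq (z k) i
  · have hqp : 0 < q.toReal := ENNReal.toReal_pos hq.ne' hqt
    have hL : ∀ k, ∑' i, z k i ^ q.toReal = lnorm q (z k) ^ q.toReal := fun k => by
      rw [lnorm_of_ne_top hqt, ← ENNReal.rpow_mul, one_div_mul_cancel hqp.ne', ENNReal.rpow_one]
    have h1 : ∑' i, (∑' k, z k i) ^ q.toReal ≤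
        ∑' k, (2 ^ (k + 1)) ^ q.toReal * lnorm q (z k) ^ q.toReal := by
      calc _ ≤ ∑' i, ∑' k, (2 ^ (k + 1)) ^ q.toReal * z k i ^ q.toReal :=
            ENNReal.tsum_le_tsum fun i => tsum_rpow_le hqp _
        _ = _ := by
            rw [ENNReal.tsum_comm]
            simp_rw [ENNReal.tsum_mul_left, hL]
    rw [lnorm_of_ne_top hqt, ← ENNReal.rpow_mul, one_div_mul_eq_div]
    refine (ENNReal.rpow_le_rpow h1 (by positivity)).trans
      ((tsum_rpow_le (by positivity) _).trans_eq ?_)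
    congr 1 with k
    rw [ENNReal.mul_rpow_of_nonneg _ _ (by positivity), ← ENNReal.rpow_mul _ q.toReal,
      ← ENNReal.rpow_mul _ q.toReal, mul_div_cancel₀ _ hqp.ne', mul_assoc]

/-- A member of the closure of the finite sequences stays in the space after multiplication by a
suitable unbounded sequence. -/
lemma exists_multiplier (hq : 0 < q) (hp : 0 < p)
    (hm : AEMeasurable (fun x => ENNReal.ofReal (w x)) volume) {a : ℕ × (Fin d → ℤ) → ℂ}
    (ha : a ∈ (fRing d s p q w).carrier)
    (h0 : ∫⁻ x, fFun d s q a x ^ p * ENNReal.ofReal (w x) ≠ 0) :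
    ∃ c : ℕ × (Fin d → ℤ) → ℕ, (∀ i, 1 ≤ c i) ∧ (∀ M : ℕ, {i | c i ≤ M}.Finite) ∧
      ∫⁻ x, fFun d s q (fun i => (c i : ℂ) * a i) x ^ p * ENNReal.ofReal (w x) ≤
        (2 ^ (p / q.toReal) * 2 ^ p + 1) *
          ∫⁻ x, fFun d s q a x ^ p * ENNReal.ofReal (w x) := by
  classical
  set I : (ℕ × (Fin d → ℤ) → ℂ) → ℝ≥0∞ :=
    fun b => ∫⁻ x, fFun d s q b x ^ p * ENNReal.ofReal (w x) with hI
  set D : ℕ → ℝ≥0∞ := fun k => (2 ^ (k + 1)) ^ (p / q.toReal) * (2 ^ (k + 1)) ^ p with hD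
  have hDt : ∀ k, D k ≠ ⊤ := fun k => ENNReal.mul_ne_top
    (ENNReal.rpow_ne_top_of_nonneg (by positivity) (by simp))
    (ENNReal.rpow_ne_top_of_nonneg hp.le (by simp))
  have hD0 : ∀ k, D k ≠ 0 := fun k => mul_ne_zero
    (ENNReal.rpow_pos (by positivity) (by simp)).ne' (ENNReal.rpow_pos (by positivity) (by simp)).ne'
  obtain ⟨-, ha⟩ := (mem_fRing_iff hp).1 ha
  -- Truncation sets whose tails are so small that they outweigh the factor `D (k + 1)` and still
  -- sum geometrically; `I a ≠ 0` makes the thresholds positive.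
  have hN : ∀ k : ℕ, ∃ N : Set (ℕ × (Fin d → ℤ)), N.Finite ∧
      D (k + 1) * I (Nᶜ.indicator a) ≤ 2⁻¹ ^ (k + 1) * I a := by
    intro k
    have hpos : 0 < (D (k + 1))⁻¹ * (2⁻¹ ^ (k + 1) * I a) :=
      ENNReal.mul_pos (ENNReal.inv_ne_zero.2 (hDt _)) (mul_ne_zero (by simp) h0)
    obtain ⟨δ, hδ, h⟩ := exists_pos_rpow_mul_lt hp ENNReal.one_ne_top hpos
    obtain ⟨N, hNf, hN⟩ := ha δ hδ
    refine ⟨N, hNf, ?_⟩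
    have := h _ hN
    rw [mul_one, fNorm_rpow hp] at this
    calc _ ≤ D (k + 1) * ((D (k + 1))⁻¹ * (2⁻¹ ^ (k + 1) * I a)) := by gcongr
      _ = _ := by rw [← mul_assoc, ENNReal.mul_inv_cancel (hD0 _) (hDt _), one_mul]
  choose N hNf hN using hN
  obtain ⟨f, hf⟩ := exists_injective_nat (ℕ × (Fin d → ℤ))
  -- Essentially the number of truncation sets that miss `i`; the bound by the enumeration `f` keeps
  -- it finite.
  set c : ℕ × (Fin d → ℤ) → ℕ := fun i => 1 + ((Finset.range (f i)).filter fun k => i ∉ N k).card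
    with hc
  refine ⟨c, fun i => Nat.le_add_right _ _, fun M => ?_, ?_⟩
  -- If `f i > M` and `i` lies in none of `N 0, …, N M`, then all these indices are counted and `c i
  -- ≥ M + 2`.
  · refine ((((Set.finite_Iic M).preimage hf.injOn)).union
      ((Finset.range (M + 1)).finite_toSet.biUnion fun k _ => hNf k)).subset ?_
    intro i hi
    by_cases hfi : f i ≤ M
    · exact Or.inl hfi
    · right
      by_contra hno
      simp only [Set.mem_iUnion, Finset.mem_coe, Finset.mem_range, exists_prop, not_exists,
        not_and] at hno
      have : Finset.range (M + 1) ⊆ (Finset.range (f i)).filter fun k => i ∉ N k := by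
        intro k hk
        have hk' := Finset.mem_range.1 hk
        exact Finset.mem_filter.2 ⟨Finset.mem_range.2 (by omega), hno k hk'⟩
      have := Finset.card_le_card this
      rw [Finset.card_range] at this
      have hi' : c i ≤ M := hi
      simp only [hc] at hi'
      omega
  -- The product `c * a` is dominated by `a` plus the sum of all tails of `a`.
  set y : ℕ → ℕ × (Fin d → ℤ) → ℂ := fun k => match k with
    | 0 => a
    | k + 1 => (N k)ᶜ.indicator a with hy
  have hdom : ∀ i, ‖(c i : ℂ) * a i‖ₑ ≤ ∑' k, ‖y k i‖ₑ := by
    intro i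
    rw [tsum_eq_zero_add' ENNReal.summable]
    have hcE : ‖(c i : ℂ)‖ₑ = (c i : ℝ≥0∞) := by
      rw [← ofReal_norm, Complex.norm_natCast, ENNReal.ofReal_natCast]
    rw [enorm_mul, hcE]
    simp only [hc, hy]
    push_cast
    rw [add_mul, one_mul]
    gcongr
    calc _ = ∑ k ∈ (Finset.range (f i)).filter (fun k => i ∉ N k), ‖(N k)ᶜ.indicator a i‖ₑ := by
          rw [← nsmul_eq_mul, ← Finset.sum_const]
          refine Finset.sum_congr rfl fun k hk => ?_
          rw [Set.indicator_of_mem]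
          exact (Finset.mem_filter.1 hk).2
      _ ≤ _ := ENNReal.sum_le_tsum _
  have hF : ∀ x, fFun d s q (fun i => (c i : ℂ) * a i) x ^ p ≤ ∑' k, D k * fFun d s q (y k) x ^ p := by
    intro x
    refine le_trans ?_ (lnorm_tsum_rpow_le hq hp fun k => fTerm d s (y k) x)
    refine ENNReal.rpow_le_rpow (lnorm_mono fun i => ?_) hp.le
    simp only [fTerm]
    rw [ENNReal.tsum_mul_right, ENNReal.tsum_mul_left]
    gcongr
    exact hdom i
  have hmk : ∀ k, AEMeasurable (fun x => fFun d s q (y k) x ^ p * ENNReal.ofReal (w x)) volume :=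
    fun k => ((measurable_fFun hq _).pow_const p).aemeasurable.mul hm
  calc _ ≤ ∫⁻ x, ∑' k, D k * (fFun d s q (y k) x ^ p * ENNReal.ofReal (w x)) := by
        refine lintegral_mono fun x => ?_
        calc _ ≤ (∑' k, D k * fFun d s q (y k) x ^ p) * ENNReal.ofReal (w x) := by
              gcongr
              exact hF x
          _ = _ := by
              rw [← ENNReal.tsum_mul_right]
              simp_rw [mul_assoc]
    _ = ∑' k, D k * I (y k) := by
        rw [lintegral_tsum fun k => (hmk k).const_mul _]
        congr 1 with k
        rw [lintegral_const_mul' _ _ (hDt k)]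
    _ = D 0 * I a + ∑' k, D (k + 1) * I ((N k)ᶜ.indicator a) := by
        rw [tsum_eq_zero_add' ENNReal.summable]
    _ ≤ D 0 * I a + ∑' k, 2⁻¹ ^ (k + 1) * I a := add_le_add le_rfl (ENNReal.tsum_le_tsum hN)
    _ = _ := by
        rw [ENNReal.tsum_mul_right, ENNReal.tsum_geometric_add_one, ENNReal.one_sub_inv_two,
          inv_inv, ENNReal.inv_mul_cancel (by simp) (by simp)]
        simp only [hD, zero_add, pow_one]
        ring

/-- Off the finite set where `c ≤ M` the division gains at least the factor `1 / M`. -/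
lemma div_mem_fRing (hq : 0 < q) (hp : 0 < p) {c : ℕ × (Fin d → ℤ) → ℕ} (hc1 : ∀ i, 1 ≤ c i)
    (hc : ∀ M : ℕ, {i | c i ≤ M}.Finite) {b : ℕ × (Fin d → ℤ) → ℂ}
    (hb : fNorm d s p q w b < ⊤) :
    (fun i => b i / c i) ∈ (fRing d s p q w).carrier ∧
      fNorm d s p q w (fun i => b i / c i) ≤ fNorm d s p q w b := by
  have hle : fNorm d s p q w (fun i => b i / c i) ≤ fNorm d s p q w b := by
    refine fNorm_mono hp fun i => ?_
    rw [norm_div, Complex.norm_natCast]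
    exact div_le_self (norm_nonneg _) (by exact_mod_cast hc1 i)
  refine ⟨(mem_fRing_iff hp).2 ⟨hle.trans_lt hb, fun ε hε => ?_⟩, hle⟩
  have ht : Tendsto (fun n : ℕ => (n : ℝ≥0∞)⁻¹ * fNorm d s p q w b) atTop (𝓝 0) := by
    simpa using ENNReal.Tendsto.mul_const ENNReal.tendsto_inv_nat_nhds_zero (Or.inr hb.ne)
  obtain ⟨M, hM, hM0⟩ := ((ht.eventually (gt_mem_nhds hε)).and (eventually_gt_atTop 0)).exists
  refine ⟨{i | c i ≤ M}, hc M, lt_of_le_of_lt ?_ hM⟩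
  have hE : ‖((M : ℂ))⁻¹‖ₑ = (M : ℝ≥0∞)⁻¹ := by
    rw [enorm_inv (by exact_mod_cast hM0.ne'), ← ofReal_norm, Complex.norm_natCast,
      ENNReal.ofReal_natCast]
  rw [← hE, ← fNorm_const_mul hq hp]
  refine fNorm_mono hp fun i => ?_
  by_cases hi : c i ≤ M
  · rw [Set.indicator_of_notMem (by simpa using hi), norm_zero]
    positivity
  · rw [Set.indicator_of_mem (by simpa using hi), norm_div, norm_mul, norm_inv,
      Complex.norm_natCast, Complex.norm_natCast, div_eq_inv_mul]
    have : (0 : ℝ) < M := by exact_mod_cast hM0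
    gcongr
    exact (not_le.1 hi).le

/-! ### Equivalence of spaces -/

lemma EqEquiv.symm {ι : Type} {X Y : QSpace ι} (h : EqEquiv X Y) : EqEquiv Y X := by
  obtain ⟨hXY, c, C, hc, hC, h⟩ := h
  refine ⟨hXY.symm, C⁻¹, c⁻¹, inv_pos.2 hC, inv_pos.2 hc, fun f hf => ?_⟩
  obtain ⟨h1, h2⟩ := h f (hXY ▸ hf)
  rw [ENNReal.coe_inv hC.ne', ENNReal.coe_inv hc.ne']
  constructor
  · exact (ENNReal.inv_mul_le_iff (by simpa using hC.ne') ENNReal.coe_ne_top).2 h2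
  · exact (ENNReal.mul_le_iff_le_inv (by simpa using hc.ne') ENNReal.coe_ne_top).1 h1

lemma EqEquiv.trans {ι : Type} {X Y Z : QSpace ι} (h : EqEquiv X Y) (h' : EqEquiv Y Z) :
    EqEquiv X Z := by
  obtain ⟨hXY, c, C, hc, hC, h⟩ := h
  obtain ⟨hYZ, c', C', hc', hC', h'⟩ := h'
  refine ⟨hXY.trans hYZ, c' * c, C' * C, by positivity, by positivity, fun f hf => ?_⟩
  obtain ⟨h1, h2⟩ := h f hf
  obtain ⟨h3, h4⟩ := h' f (hXY ▸ hf)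
  push_cast
  rw [mul_assoc, mul_assoc]
  exact ⟨(by gcongr : _ ≤ (c' : ℝ≥0∞) * Y.qnorm f).trans h3, h4.trans (by gcongr)⟩

/-- A space is the Calderón product of two others if it contains all dominated functions and
if its members factor, both with control of the quasi-norms. -/
lemma eqEquiv_calderonProduct {ι : Type} {Θ : ℝ} {X₀ X₁ Y : QSpace ι}
    (hΘ0 : 0 < Θ) (hΘ1 : Θ < 1) (h₀ : ∀ f ∈ X₀.carrier, X₀.qnorm f < ⊤)
    (h₁ : ∀ f ∈ X₁.carrier, X₁.qnorm f < ⊤)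
    (hle : ∀ f, ∀ f₀ ∈ X₀.carrier, ∀ f₁ ∈ X₁.carrier,
      (∀ i, ‖f i‖ ≤ ‖f₀ i‖ ^ (1 - Θ) * ‖f₁ i‖ ^ Θ) →
      f ∈ Y.carrier ∧ Y.qnorm f ≤ X₀.qnorm f₀ ^ (1 - Θ) * X₁.qnorm f₁ ^ Θ)
    {C : ℝ≥0∞} (hC : C ≠ ⊤) (hge : ∀ f ∈ Y.carrier, ∃ f₀ ∈ X₀.carrier, ∃ f₁ ∈ X₁.carrier,
      (∀ i, ‖f i‖ ≤ ‖f₀ i‖ ^ (1 - Θ) * ‖f₁ i‖ ^ Θ) ∧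
      X₀.qnorm f₀ ^ (1 - Θ) * X₁.qnorm f₁ ^ Θ ≤ C * Y.qnorm f) :
    EqEquiv (calderonProduct Θ X₀ X₁) Y := by
  lift C to ℝ≥0 using hC
  have hΘ : 0 ≤ 1 - Θ := by linarith
  have hcar : (calderonProduct Θ X₀ X₁).carrier = Y.carrier := by
    ext f
    constructor
    · intro hf
      simp only [calderonProduct, Set.mem_ofPred_eq, iInf_lt_iff] at hf
      obtain ⟨f₀, hf₀, f₁, hf₁, hdom, -⟩ := hf
      exact (hle f f₀ hf₀ f₁ hf₁ hdom).1
    · intro hf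
      obtain ⟨f₀, hf₀, f₁, hf₁, hdom, -⟩ := hge f hf
      simp only [calderonProduct, Set.mem_ofPred_eq, iInf_lt_iff]
      exact ⟨f₀, hf₀, f₁, hf₁, hdom, ENNReal.mul_lt_top
        (ENNReal.rpow_lt_top_of_nonneg hΘ (h₀ f₀ hf₀).ne)
        (ENNReal.rpow_lt_top_of_nonneg hΘ0.le (h₁ f₁ hf₁).ne)⟩
  -- The summand `1` guards against `C = 0`.
  refine ⟨hcar, (C + 1)⁻¹, 1, by positivity, one_pos, fun f hf => ⟨?_, ?_⟩⟩
  · rw [hcar] at hf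
    obtain ⟨f₀, hf₀, f₁, hf₁, hdom, hCf⟩ := hge f hf
    rw [ENNReal.coe_inv (by positivity)]
    refine (ENNReal.inv_mul_le_iff (by simp) ENNReal.coe_ne_top).2 ?_
    calc _ ≤ X₀.qnorm f₀ ^ (1 - Θ) * X₁.qnorm f₁ ^ Θ :=
          iInf₂_le_of_le f₀ hf₀ (iInf₂_le_of_le f₁ hf₁ (iInf_le _ hdom))
      _ ≤ C * Y.qnorm f := hCf
      _ ≤ _ := by
          gcongr
          simp
  · rw [ENNReal.coe_one, one_mul]
    exact le_iInf₂ fun f₀ hf₀ => le_iInf₂ fun f₁ hf₁ => le_iInf fun hdom =>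
      (hle f f₀ hf₀ f₁ hf₁ hdom).2

/-- A weight may be replaced by a measurable one with positive finite values. -/
lemma IsLocMuckenhouptInfty.exists_measurable (hd : 1 ≤ d) (hw : IsLocMuckenhouptInfty d w) :
    ∃ (v : EuclideanSpace ℝ (Fin d) → ℝ≥0∞) (K : ℝ≥0∞), Measurable v ∧ (∀ x, v x ≠ 0) ∧
      (∀ x, v x ≠ ⊤) ∧ (v =ᵐ[volume] fun x => ENNReal.ofReal (w x)) ∧ K ≠ ⊤ ∧ DyadicLarge v K := by
  classical
  obtain ⟨r, hr, hw⟩ := hw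
  obtain ⟨K, hK, h⟩ := hw.exists_dyadicCube_le hd hr
  set g := hw.aemeasurable.mk with hg
  have hgm : Measurable g := hw.aemeasurable.measurable_mk
  have hset : MeasurableSet {x | g x ≠ 0 ∧ g x ≠ ⊤} :=
    (hgm (measurableSet_singleton 0).compl).inter (hgm (measurableSet_singleton ⊤).compl)
  -- Altered only on the null set where the measurable representative is zero or infinite.
  set v : EuclideanSpace ℝ (Fin d) → ℝ≥0∞ := fun x => if g x ≠ 0 ∧ g x ≠ ⊤ then g x else 1 with hv
  have hae : v =ᵐ[volume] fun x => ENNReal.ofReal (w x) := by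
    filter_upwards [hw.aemeasurable.ae_eq_mk, hw.2.2.1] with x hx hpos
    simp only [hv]
    rw [if_pos]
    · exact hx.symm
    · rw [hg, ← hx]
      exact ⟨by simpa using hpos, ENNReal.ofReal_ne_top⟩
  refine ⟨v, K, Measurable.ite hset hgm measurable_const, fun x => ?_, fun x => ?_, hae, hK, ?_⟩
  · simp only [hv]
    split_ifs with h
    · exact h.1
    · exact one_ne_zero
  · simp only [hv]
    split_ifs with h
    · exact h.2
    · exact ENNReal.one_ne_top
  · unfold DyadicLarge
    rw [withDensity_congr_ae hae]
    exact h

end Closures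

/-! ### Factorization within the closures and the theorem -/

section Main

variable {d : ℕ}

/-- Members of the closure of the finite sequences factor within such closures. -/
lemma exists_factorization_fRing (hd : 1 ≤ d) {Θ : ℝ} (hΘ0 : 0 < Θ) (hΘ1 : Θ < 1)
    {p₀ p₁ p : ℝ} (hp₀ : 0 < p₀) (hp₁ : 0 < p₁) (hp0 : 0 < p)
    (hp : 1 / p = (1 - Θ) / p₀ + Θ / p₁) {q₀ q₁ q : ℝ≥0∞} (hq₀ : 0 < q₀) (hq₁ : 0 < q₁)
    (hq : 1 / q = ENNReal.ofReal (1 - Θ) / q₀ + ENNReal.ofReal Θ / q₁) {s₀ s₁ s : ℝ}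
    (hs : s = (1 - Θ) * s₀ + Θ * s₁) {w₀ w₁ w : EuclideanSpace ℝ (Fin d) → ℝ}
    (hw₀ : IsLocMuckenhouptInfty d w₀) (hw₁ : IsLocMuckenhouptInfty d w₁)
    (hw : ∀ x, ENNReal.ofReal (w x) = ENNReal.ofReal (w₀ x) ^ ((1 - Θ) * p / p₀) *
      ENNReal.ofReal (w₁ x) ^ (Θ * p / p₁)) :
    ∃ C : ℝ≥0∞, C ≠ ⊤ ∧ ∀ a ∈ (fRing d s p q w).carrier,
      ∃ a₀ ∈ (fRing d s₀ p₀ q₀ w₀).carrier, ∃ a₁ ∈ (fRing d s₁ p₁ q₁ w₁).carrier,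
        (∀ i, ‖a i‖ ≤ ‖a₀ i‖ ^ (1 - Θ) * ‖a₁ i‖ ^ Θ) ∧
        fNorm d s₀ p₀ q₀ w₀ a₀ ^ (1 - Θ) * fNorm d s₁ p₁ q₁ w₁ a₁ ^ Θ ≤
          C * fNorm d s p q w a := by
  have hΘ : 0 < 1 - Θ := by linarith
  have hq0 : 0 < q := (exists_exponents hΘ0 hΘ1 hq₀ hq₁ hq).1
  obtain ⟨v₀, K₀, hm₀, hz₀, ht₀, hae₀, hK₀, hD₀⟩ := hw₀.exists_measurable hd
  obtain ⟨v₁, K₁, hm₁, hz₁, ht₁, hae₁, hK₁, hD₁⟩ := hw₁.exists_measurable hd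
  set v : EuclideanSpace ℝ (Fin d) → ℝ≥0∞ :=
    fun x => v₀ x ^ ((1 - Θ) * p / p₀) * v₁ x ^ (Θ * p / p₁) with hv
  have hvm : Measurable v := (hm₀.pow_const _).mul (hm₁.pow_const _)
  have hae : v =ᵐ[volume] fun x => ENNReal.ofReal (w x) := by
    filter_upwards [hae₀, hae₁] with x h0 h1
    simp only [hv]
    rw [hw, h0, h1]
  have hm : AEMeasurable (fun x => ENNReal.ofReal (w x)) volume := hvm.aemeasurable.congr hae
  obtain ⟨C, hC, hfac⟩ := exists_factorization hΘ0 hΘ1 hp₀ hp₁ hp0 hp hq₀ hq₁ hq hs hm₀ hm₁ hz₀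
    hz₁ ht₀ ht₁ (v := v) (fun x => rfl) hK₀ hK₁ hD₀ hD₁
  have hcongr : ∀ {g v' : EuclideanSpace ℝ (Fin d) → ℝ≥0∞} {w' : EuclideanSpace ℝ (Fin d) → ℝ},
      (v' =ᵐ[volume] fun x => ENNReal.ofReal (w' x)) →
      ∫⁻ x, g x * v' x = ∫⁻ x, g x * ENNReal.ofReal (w' x) := fun h => by
    refine lintegral_congr_ae ?_
    filter_upwards [h] with x hx
    rw [hx]
  simp_rw [hcongr hae, hcongr hae₀, hcongr hae₁] at hfac
  set E : ℝ≥0∞ := 2 ^ (p / q.toReal) * 2 ^ p + 1 with hE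
  have hEt : E ≠ ⊤ := ENNReal.add_ne_top.2
    ⟨ENNReal.mul_ne_top (two_rpow_ne_top _) (two_rpow_ne_top _), ENNReal.one_ne_top⟩
  refine ⟨(C * E) ^ (1 / p),
    ENNReal.rpow_ne_top_of_nonneg (by positivity) (ENNReal.mul_ne_top hC hEt), fun a ha => ?_⟩
  have haI : ∫⁻ x, fFun d s q a x ^ p * ENNReal.ofReal (w x) ≠ ⊤ := by
    rw [← fNorm_rpow hp0]
    exact ENNReal.rpow_ne_top_of_nonneg hp0.le ha.1.ne
  set I := ∫⁻ x, fFun d s q a x ^ p * ENNReal.ofReal (w x) with hI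
  have hprod : ∀ a₀ a₁ : ℕ × (Fin d → ℤ) → ℂ,
      fNorm d s₀ p₀ q₀ w₀ a₀ ≤ (C * (E * I)) ^ (1 / p₀) →
      fNorm d s₁ p₁ q₁ w₁ a₁ ≤ (C * (E * I)) ^ (1 / p₁) →
      fNorm d s₀ p₀ q₀ w₀ a₀ ^ (1 - Θ) * fNorm d s₁ p₁ q₁ w₁ a₁ ^ Θ ≤
          (C * E) ^ (1 / p) * fNorm d s p q w a := by
    intro a₀ a₁ h0 h1
    calc _ ≤ ((C * (E * I)) ^ (1 / p₀)) ^ (1 - Θ) * ((C * (E * I)) ^ (1 / p₁)) ^ Θ := by gcongr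
      _ = (C * (E * I)) ^ (1 / p) := by
          rw [← ENNReal.rpow_mul, ← ENNReal.rpow_mul,
            ← ENNReal.rpow_add_of_nonneg _ _ (by positivity) (by positivity), hp]
          congr 1
          ring
      _ = _ := by
          rw [← mul_assoc, ENNReal.mul_rpow_of_nonneg _ _ (by positivity), fNorm]
  have hfin : ∀ {p' : ℝ}, 0 < p' → (C * (E * I)) ^ (1 / p') < ⊤ := fun hp' =>
    ENNReal.rpow_lt_top_of_nonneg (by positivity)
      (ENNReal.mul_ne_top hC (ENNReal.mul_ne_top hEt haI))
  -- For `I = 0` there is no room for the multiplier, but then both factors have quasi-norm zero and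
  -- the empty set is a sufficient truncation.
  rcases eq_or_ne I 0 with hI0 | hI0
  · obtain ⟨a₀, a₁, hdom, h0, h1⟩ := hfac a haI
    have hmem : ∀ {s' p' : ℝ} {q' : ℝ≥0∞} {w' : EuclideanSpace ℝ (Fin d) → ℝ}
        {b : ℕ × (Fin d → ℤ) → ℂ}, 0 < p' →
        ∫⁻ x, fFun d s' q' b x ^ p' * ENNReal.ofReal (w' x) ≤ C * I →
        fNorm d s' p' q' w' b = 0 ∧ b ∈ (fRing d s' p' q' w').carrier := by
      intro s' p' q' w' b hp' hb
      have hb0 : fNorm d s' p' q' w' b = 0 := by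
        rw [hI0, mul_zero] at hb
        rw [fNorm, le_antisymm hb zero_le, ENNReal.zero_rpow_of_pos (by positivity)]
      refine ⟨hb0, (mem_fRing_iff hp').2 ⟨by simp [hb0], fun ε hε => ⟨∅, Set.finite_empty, ?_⟩⟩⟩
      rwa [Set.compl_empty, Set.indicator_univ, hb0]
    obtain ⟨n0, m0⟩ := hmem hp₀ h0
    obtain ⟨n1, m1⟩ := hmem hp₁ h1
    exact ⟨a₀, m0, a₁, m1, hdom, hprod _ _ (by simp [n0]) (by simp [n1])⟩
  -- Factor `c * a`, then divide both factors by `c`; the powers `1 - Θ` and `Θ` of `c` restore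
  -- exactly `c`.
  · obtain ⟨c, hc1, hc, hcI⟩ := exists_multiplier hq0 hp0 hm ha hI0
    obtain ⟨b₀, b₁, hdom, h0, h1⟩ := hfac (fun i => (c i : ℂ) * a i)
      (ne_top_of_le_ne_top (ENNReal.mul_ne_top hEt haI) hcI)
    have hb₀ : fNorm d s₀ p₀ q₀ w₀ b₀ ≤ (C * (E * I)) ^ (1 / p₀) :=
      ENNReal.rpow_le_rpow (h0.trans (by gcongr)) (by positivity)
    have hb₁ : fNorm d s₁ p₁ q₁ w₁ b₁ ≤ (C * (E * I)) ^ (1 / p₁) :=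
      ENNReal.rpow_le_rpow (h1.trans (by gcongr)) (by positivity)
    obtain ⟨m0, l0⟩ := div_mem_fRing hq₀ hp₀ hc1 hc (hb₀.trans_lt (hfin hp₀))
    obtain ⟨m1, l1⟩ := div_mem_fRing hq₁ hp₁ hc1 hc (hb₁.trans_lt (hfin hp₁))
    refine ⟨_, m0, _, m1, fun i => ?_, hprod _ _ (l0.trans hb₀) (l1.trans hb₁)⟩
    have hci : (0 : ℝ) < c i := by exact_mod_cast hc1 i
    have := hdom i
    rw [norm_mul, Complex.norm_natCast] at this
    rw [norm_div, norm_div, Complex.norm_natCast, Real.div_rpow (norm_nonneg _) hci.le,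
      Real.div_rpow (norm_nonneg _) hci.le, div_mul_div_comm, ← Real.rpow_add hci, sub_add_cancel,
      Real.rpow_one, le_div_iff₀ hci, mul_comm]
    exact this

end Main

end WeightedSeq

theorem theorem17 (d : ℕ) (hd : 1 ≤ d) (Θ : ℝ) (hΘ0 : 0 < Θ) (hΘ1 : Θ < 1)
    (p₀ p₁ p : ℝ) (hp₀ : 0 < p₀) (hp₁ : 0 < p₁) (hp : 1 / p = (1 - Θ) / p₀ + Θ / p₁)
    (q₀ q₁ q : ℝ≥0∞) (hq₀ : 0 < q₀) (hq₁ : 0 < q₁)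
    (hq : 1 / q = ENNReal.ofReal (1 - Θ) / q₀ + ENNReal.ofReal Θ / q₁)
    (s₀ s₁ s : ℝ) (hs : s = (1 - Θ) * s₀ + Θ * s₁)
    (w₀ w₁ w : EuclideanSpace ℝ (Fin d) → ℝ)
    (hw₀ : WeightedSeq.IsLocMuckenhouptInfty d w₀) (hw₁ : WeightedSeq.IsLocMuckenhouptInfty d w₁)
    (hw : ∀ x, w x = w₀ x ^ ((1 - Θ) * p / p₀) * w₁ x ^ (Θ * p / p₁)) :
    WeightedSeq.EqEquiv
      (WeightedSeq.calderonProduct Θ (WeightedSeq.fRing d s₀ p₀ q₀ w₀)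
        (WeightedSeq.fRing d s₁ p₁ q₁ w₁))
      (WeightedSeq.fRing d s p q w) ∧
    WeightedSeq.EqEquiv
      (WeightedSeq.calderonProduct Θ (WeightedSeq.fRing d s₀ p₀ q₀ w₀)
        (WeightedSeq.fSpace d s₁ p₁ q₁ w₁))
      (WeightedSeq.calderonProduct Θ (WeightedSeq.fSpace d s₀ p₀ q₀ w₀)
        (WeightedSeq.fRing d s₁ p₁ q₁ w₁)) ∧
    WeightedSeq.EqEquiv
      (WeightedSeq.calderonProduct Θ (WeightedSeq.fSpace d s₀ p₀ q₀ w₀)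
        (WeightedSeq.fRing d s₁ p₁ q₁ w₁))
      (WeightedSeq.fRing d s p q w) := by
  open WeightedSeq in
  have hΘ : 0 < 1 - Θ := by linarith
  have hp0 : 0 < p := by
    rw [← one_div_pos, hp]
    positivity
  have hq0 : 0 < q := (exists_exponents hΘ0 hΘ1 hq₀ hq₁ hq).1
  have hwE : ∀ x, ENNReal.ofReal (w x) = ENNReal.ofReal (w₀ x) ^ ((1 - Θ) * p / p₀) *
      ENNReal.ofReal (w₁ x) ^ (Θ * p / p₁) := fun x => by
    obtain ⟨_, _, h₀⟩ := hw₀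
    obtain ⟨_, _, h₁⟩ := hw₁
    rw [hw, ENNReal.ofReal_mul (Real.rpow_nonneg (h₀.1 x) _),
      ENNReal.ofReal_rpow_of_nonneg (h₀.1 x) (by positivity),
      ENNReal.ofReal_rpow_of_nonneg (h₁.1 x) (by positivity)]
  have hm₀ : AEMeasurable (fun x => ENNReal.ofReal (w₀ x)) MeasureTheory.volume :=
    hw₀.choose_spec.2.aemeasurable
  have hm₁ : AEMeasurable (fun x => ENNReal.ofReal (w₁ x)) MeasureTheory.volume :=
    hw₁.choose_spec.2.aemeasurable
  have holder : ∀ a a₀ a₁ : ℕ × (Fin d → ℤ) → ℂ, (∀ i, ‖a i‖ ≤ ‖a₀ i‖ ^ (1 - Θ) * ‖a₁ i‖ ^ Θ) →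
      fNorm d s p q w a ≤ fNorm d s₀ p₀ q₀ w₀ a₀ ^ (1 - Θ) * fNorm d s₁ p₁ q₁ w₁ a₁ ^ Θ :=
    fun a a₀ a₁ h =>
      fNorm_le_of_dominated hΘ0 hΘ1 hp₀ hp₁ hp0 hp hq0 hq₀ hq₁ hq hs hm₀ hm₁ hwE h
  have hfin : ∀ {x y : ℝ≥0∞}, x < ⊤ → y < ⊤ → x ^ (1 - Θ) * y ^ Θ < ⊤ := fun hx hy =>
    ENNReal.mul_lt_top (ENNReal.rpow_lt_top_of_nonneg hΘ.le hx.ne)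
      (ENNReal.rpow_lt_top_of_nonneg hΘ0.le hy.ne)
  have hind : ∀ (N : Set (ℕ × (Fin d → ℤ))) (a : ℕ × (Fin d → ℤ) → ℂ) (i),
      ‖N.indicator a i‖ ≤ ‖a i‖ := fun N a i => norm_indicator_le_norm_self _ _
  have hleft : ∀ a, ∀ a₀ ∈ (fRing d s₀ p₀ q₀ w₀).carrier, ∀ a₁ ∈ (fSpace d s₁ p₁ q₁ w₁).carrier,
      (∀ i, ‖a i‖ ≤ ‖a₀ i‖ ^ (1 - Θ) * ‖a₁ i‖ ^ Θ) → a ∈ (fRing d s p q w).carrier ∧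
      fNorm d s p q w a ≤ fNorm d s₀ p₀ q₀ w₀ a₀ ^ (1 - Θ) * fNorm d s₁ p₁ q₁ w₁ a₁ ^ Θ := by
    intro a a₀ h₀ a₁ (h₁ : fNorm d s₁ p₁ q₁ w₁ a₁ < ⊤) hdom
    obtain ⟨hf₀, h₀⟩ := (mem_fRing_iff hp₀).1 h₀
    refine ⟨(mem_fRing_iff hp0).2 ⟨(holder a a₀ a₁ hdom).trans_lt (hfin hf₀ h₁), fun ε hε => ?_⟩,
      holder a a₀ a₁ hdom⟩
    -- Smallness of the tail of `a₀` alone suffices: the other factor stays bounded by its full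
    -- quasi-norm.
    obtain ⟨δ, hδ, hlt⟩ := exists_pos_rpow_mul_lt hΘ
      (ENNReal.rpow_ne_top_of_nonneg hΘ0.le h₁.ne) hε
    obtain ⟨N, hN, hNδ⟩ := h₀ δ hδ
    refine ⟨N, hN, lt_of_le_of_lt ?_ (hlt _ hNδ)⟩
    refine (holder _ _ _ (norm_indicator_le_of_dominated hdom Nᶜ)).trans ?_
    gcongr
    exact fNorm_mono hp₁ (hind _ _)
  have hright : ∀ a, ∀ a₀ ∈ (fSpace d s₀ p₀ q₀ w₀).carrier, ∀ a₁ ∈ (fRing d s₁ p₁ q₁ w₁).carrier,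
      (∀ i, ‖a i‖ ≤ ‖a₀ i‖ ^ (1 - Θ) * ‖a₁ i‖ ^ Θ) → a ∈ (fRing d s p q w).carrier ∧
      fNorm d s p q w a ≤ fNorm d s₀ p₀ q₀ w₀ a₀ ^ (1 - Θ) * fNorm d s₁ p₁ q₁ w₁ a₁ ^ Θ := by
    intro a a₀ (h₀ : fNorm d s₀ p₀ q₀ w₀ a₀ < ⊤) a₁ h₁ hdom
    obtain ⟨hf₁, h₁⟩ := (mem_fRing_iff hp₁).1 h₁
    refine ⟨(mem_fRing_iff hp0).2 ⟨(holder a a₀ a₁ hdom).trans_lt (hfin h₀ hf₁), fun ε hε => ?_⟩,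
      holder a a₀ a₁ hdom⟩
    obtain ⟨δ, hδ, hlt⟩ := exists_pos_rpow_mul_lt hΘ0
      (ENNReal.rpow_ne_top_of_nonneg hΘ.le h₀.ne) hε
    obtain ⟨N, hN, hNδ⟩ := h₁ δ hδ
    refine ⟨N, hN, lt_of_le_of_lt ?_ (hlt _ hNδ)⟩
    refine (holder _ _ _ (norm_indicator_le_of_dominated hdom Nᶜ)).trans ?_
    rw [mul_comm]
    gcongr
    exact fNorm_mono hp₀ (hind _ _)
  -- Both factors lie in closures, hence also in the full spaces, so this one factorization settles
  -- the mixed products too.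
  obtain ⟨C, hC, hfac⟩ := exists_factorization_fRing hd hΘ0 hΘ1 hp₀ hp₁ hp0 hp hq₀ hq₁ hq hs hw₀
    hw₁ hwE
  have e : EqEquiv (calderonProduct Θ (fRing d s₀ p₀ q₀ w₀) (fRing d s₁ p₁ q₁ w₁))
      (fRing d s p q w) :=
    eqEquiv_calderonProduct hΘ0 hΘ1 (fun _ h => h.1) (fun _ h => h.1)
      (fun a a₀ h₀ a₁ h₁ => hleft a a₀ h₀ a₁ h₁.1) hC hfac
  have el : EqEquiv (calderonProduct Θ (fRing d s₀ p₀ q₀ w₀) (fSpace d s₁ p₁ q₁ w₁))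
      (fRing d s p q w) :=
    eqEquiv_calderonProduct hΘ0 hΘ1 (fun _ h => h.1) (fun _ h => h) hleft hC fun a ha => by
      obtain ⟨a₀, h₀, a₁, h₁, h⟩ := hfac a ha
      exact ⟨a₀, h₀, a₁, h₁.1, h⟩
  have er : EqEquiv (calderonProduct Θ (fSpace d s₀ p₀ q₀ w₀) (fRing d s₁ p₁ q₁ w₁))
      (fRing d s p q w) :=
    eqEquiv_calderonProduct hΘ0 hΘ1 (fun _ h => h) (fun _ h => h.1) hright hC fun a ha => by
      obtain ⟨a₀, h₀, a₁, h₁, h⟩ := hfac a ha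
      exact ⟨a₀, h₀.1, a₁, h₁, h⟩
  exact ⟨e, el.trans er.symm, er⟩
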